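/- There are a deterministic real-RAM program and a function $T:\mathbb{N}\to\mathbb{N}$ with $T(n)=O(n\log^2 n)$ such that the following holds. Let $P,Q$ be multisets of $n$ points of $\mathbb{R}^2$, let $L_1: a_1x+b_1y\ge c_1$ and $L_2: a_2x+b_2y\ge c_2$ be two linear constraints, let $f(x,y)=dx+ey$ be a linear objective function (all coefficients are arbitrary real numbers and belong to the input), and let $(P\oplus Q)_{L_1,L_2}$ be the multiset of the sums $p+q$, one for each pair $(p,q)$ with $p\in P$ and $q\in Q$, that satisfy both constraints. Let $k$ be a positive integer that is at most the number of elements of $(P\oplus Q)_{L_1,L_2}$. Then, given $P$, $Q$ (each listed in an arbitrary order), $L_1$, $L_2$, $f$ and $k$, the program halts after at most $T(n)$ steps and outputs the $k$-th largest element (counted with multiplicity) of the multiset of the values $f(v)$, $v\in(P\oplus Q)_{L_1,L_2}$. Here a real RAM performs exact real arithmetic $+,-,\times,/$ and comparisons, arithmetic on integer words of $O(\log n)$ bits, and random access to memory, each at unit cost. -/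

import Mathlib

open Filter Asymptotics

/-! ## A real RAM with word-sized integers

A program works on a memory of integer words (for counting and for addressing) and a memory of
exact real numbers, each with scalar variables and random-access arrays.  Reals can be added,
subtracted, multiplied, divided and compared at unit cost; words can be cast to reals, but there
is no rounding of reals to integers and there are no real constants other than quotients of
integers. -/

namespace RealRAM

/-- The memory: word variables `w x`, word arrays `wa a i`, real variables `r x`, real arrays
`ra a i`.  A fixed program only mentions finitely many variables and arrays. -/
structure State where
  w : ℕ → ℕ
  wa : ℕ → ℕ → ℕ
  r : ℕ → ℝ
  ra : ℕ → ℕ → ℝ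

/-- Integer expressions. -/
inductive WExp where
  | lit (m : ℕ)
  | var (x : ℕ)
  | get (a : ℕ) (i : WExp)
  | add (e₁ e₂ : WExp)
  | sub (e₁ e₂ : WExp)
  | mul (e₁ e₂ : WExp)
  | div (e₁ e₂ : WExp)

/-- Real expressions; `ofWord` casts an integer to a real. -/
inductive RExp where
  | ofWord (e : WExp)
  | var (x : ℕ)
  | get (a : ℕ) (i : WExp)
  | add (e₁ e₂ : RExp)
  | sub (e₁ e₂ : RExp)
  | mul (e₁ e₂ : RExp)
  | div (e₁ e₂ : RExp)

/-- Tests. -/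
inductive BExp where
  | wle (e₁ e₂ : WExp)
  | rle (e₁ e₂ : RExp)
  | not (b : BExp)
  | and (b₁ b₂ : BExp)

/-- Subtraction is truncated at `0`, division is rounded down, and division by `0` gives `0`. -/
def WExp.eval (s : State) : WExp → ℕ
  | .lit m => m
  | .var x => s.w x
  | .get a i => s.wa a (i.eval s)
  | .add e₁ e₂ => e₁.eval s + e₂.eval s
  | .sub e₁ e₂ => e₁.eval s - e₂.eval s
  | .mul e₁ e₂ => e₁.eval s * e₂.eval s
  | .div e₁ e₂ => e₁.eval s / e₂.eval s

/-- Exact real arithmetic; division by `0` gives `0`. -/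
noncomputable def RExp.eval (s : State) : RExp → ℝ
  | .ofWord e => (e.eval s : ℝ)
  | .var x => s.r x
  | .get a i => s.ra a (i.eval s)
  | .add e₁ e₂ => e₁.eval s + e₂.eval s
  | .sub e₁ e₂ => e₁.eval s - e₂.eval s
  | .mul e₁ e₂ => e₁.eval s * e₂.eval s
  | .div e₁ e₂ => e₁.eval s / e₂.eval s

def BExp.Holds (s : State) : BExp → Prop
  | .wle e₁ e₂ => e₁.eval s ≤ e₂.eval s
  | .rle e₁ e₂ => e₁.eval s ≤ e₂.eval s
  | .not b => ¬ b.Holds s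
  | .and b₁ b₂ => b₁.Holds s ∧ b₂.Holds s

/-- Unit cost: an expression costs the number of its nodes. -/
def WExp.cost : WExp → ℕ
  | .lit _ => 1
  | .var _ => 1
  | .get _ i => i.cost + 1
  | .add e₁ e₂ => e₁.cost + e₂.cost + 1
  | .sub e₁ e₂ => e₁.cost + e₂.cost + 1
  | .mul e₁ e₂ => e₁.cost + e₂.cost + 1
  | .div e₁ e₂ => e₁.cost + e₂.cost + 1

def RExp.cost : RExp → ℕ
  | .ofWord e => e.cost + 1
  | .var _ => 1
  | .get _ i => i.cost + 1
  | .add e₁ e₂ => e₁.cost + e₂.cost + 1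
  | .sub e₁ e₂ => e₁.cost + e₂.cost + 1
  | .mul e₁ e₂ => e₁.cost + e₂.cost + 1
  | .div e₁ e₂ => e₁.cost + e₂.cost + 1

def BExp.cost : BExp → ℕ
  | .wle e₁ e₂ => e₁.cost + e₂.cost + 1
  | .rle e₁ e₂ => e₁.cost + e₂.cost + 1
  | .not b => b.cost + 1
  | .and b₁ b₂ => b₁.cost + b₂.cost + 1

/-- Programs: assignments to variables and to array cells, sequencing, branching, loops. -/
inductive Program where
  | skip
  | setW (x : ℕ) (e : WExp)
  | putW (a : ℕ) (i e : WExp)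
  | setR (x : ℕ) (e : RExp)
  | putR (a : ℕ) (i : WExp) (e : RExp)
  | seq (p₁ p₂ : Program)
  | branch (b : BExp) (p₁ p₂ : Program)
  | loop (b : BExp) (p : Program)

/-- Assignments to a variable or to an array cell. -/
def State.setW (s : State) (x v : ℕ) : State :=
  { s with w := Function.update s.w x v }

def State.putW (s : State) (a i v : ℕ) : State :=
  { s with wa := Function.update s.wa a (Function.update (s.wa a) i v) }

noncomputable def State.setR (s : State) (x : ℕ) (v : ℝ) : State :=
  { s with r := Function.update s.r x v }

noncomputable def State.putR (s : State) (a i : ℕ) (v : ℝ) : State :=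
  { s with ra := Function.update s.ra a (Function.update (s.ra a) i v) }

/-- `Exec W p s s' t`: started in memory `s`, the program `p` halts in memory `s'` after `t` unit
cost steps.  Here `W` bounds the machine word: a run that stores an integer `≥ W`, or stores
at an address `≥ W`, is stuck.  (Intermediate values inside the expressions of a fixed program
are then at most a fixed power of `W`.) -/
inductive Exec (W : ℕ) : Program → State → State → ℕ → Prop where
  | skip (s : State) : Exec W .skip s s 1
  | setW (s : State) (x : ℕ) (e : WExp) (he : e.eval s < W) :
      Exec W (.setW x e) s (s.setW x (e.eval s)) (e.cost + 1)
  | putW (s : State) (a : ℕ) (i e : WExp) (hi : i.eval s < W) (he : e.eval s < W) :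
      Exec W (.putW a i e) s (s.putW a (i.eval s) (e.eval s)) (i.cost + e.cost + 1)
  | setR (s : State) (x : ℕ) (e : RExp) :
      Exec W (.setR x e) s (s.setR x (e.eval s)) (e.cost + 1)
  | putR (s : State) (a : ℕ) (i : WExp) (e : RExp) (hi : i.eval s < W) :
      Exec W (.putR a i e) s (s.putR a (i.eval s) (e.eval s)) (i.cost + e.cost + 1)
  | seq {p₁ p₂ : Program} {s s' s'' : State} {t₁ t₂ : ℕ}
      (h₁ : Exec W p₁ s s' t₁) (h₂ : Exec W p₂ s' s'' t₂) :
      Exec W (.seq p₁ p₂) s s'' (t₁ + t₂)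
  | branchTrue {b : BExp} {p₁ p₂ : Program} {s s' : State} {t : ℕ}
      (hb : b.Holds s) (h : Exec W p₁ s s' t) :
      Exec W (.branch b p₁ p₂) s s' (b.cost + t + 1)
  | branchFalse {b : BExp} {p₁ p₂ : Program} {s s' : State} {t : ℕ}
      (hb : ¬ b.Holds s) (h : Exec W p₂ s s' t) :
      Exec W (.branch b p₁ p₂) s s' (b.cost + t + 1)
  | loopDone {b : BExp} {p : Program} {s : State} (hb : ¬ b.Holds s) :
      Exec W (.loop b p) s s (b.cost + 1)
  | loopStep {b : BExp} {p : Program} {s s' s'' : State} {t₁ t₂ : ℕ}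
      (hb : b.Holds s) (h₁ : Exec W p s s' t₁) (h₂ : Exec W (.loop b p) s' s'' t₂) :
      Exec W (.loop b p) s s'' (b.cost + t₁ + t₂ + 1)

/-- The machine is deterministic: the final memory and the running time are determined by the
program and the initial memory. -/
theorem Exec.deterministic {W : ℕ} {p : Program} {s s₁ s₂ : State} {t₁ t₂ : ℕ}
    (h₁ : Exec W p s s₁ t₁) (h₂ : Exec W p s s₂ t₂) : s₁ = s₂ ∧ t₁ = t₂ := by
  induction h₁ generalizing s₂ t₂ with
  | skip | setW | putW | setR | putR => cases h₂; exact ⟨rfl, rfl⟩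
  | seq _ _ ih₁ ih₂ =>
    cases h₂ with
    | seq g₁ g₂ =>
      obtain ⟨rfl, rfl⟩ := ih₁ g₁
      obtain ⟨rfl, rfl⟩ := ih₂ g₂
      exact ⟨rfl, rfl⟩
  | branchTrue hb _ ih =>
    cases h₂ with
    | branchTrue _ g => obtain ⟨rfl, rfl⟩ := ih g; exact ⟨rfl, rfl⟩
    | branchFalse hb' _ => exact absurd hb hb'
  | branchFalse hb _ ih =>
    cases h₂ with
    | branchTrue hb' _ => exact absurd hb' hb
    | branchFalse _ g => obtain ⟨rfl, rfl⟩ := ih g; exact ⟨rfl, rfl⟩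
  | loopDone hb =>
    cases h₂ with
    | loopDone _ => exact ⟨rfl, rfl⟩
    | loopStep hb' _ _ => exact absurd hb' hb
  | loopStep hb _ _ ih₁ ih₂ =>
    cases h₂ with
    | loopDone hb' => exact absurd hb hb'
    | loopStep _ g₁ g₂ =>
      obtain ⟨rfl, rfl⟩ := ih₁ g₁
      obtain ⟨rfl, rfl⟩ := ih₂ g₂
      exact ⟨rfl, rfl⟩

end RealRAM

/-! ## Minkowski sum selection with two linear constraints -/

namespace MinkowskiSelection

/-- The linear constraint `a * x + b * y ≥ c` on the points `(x, y)` of the plane. -/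
structure LinearConstraint where
  a : ℝ
  b : ℝ
  c : ℝ

def LinearConstraint.Holds (L : LinearConstraint) (v : ℝ × ℝ) : Prop :=
  L.a * v.1 + L.b * v.2 ≥ L.c

/-- The linear objective function `(x, y) ↦ d * x + e * y`. -/
structure LinearObjective where
  d : ℝ
  e : ℝ

def LinearObjective.value (f : LinearObjective) (v : ℝ × ℝ) : ℝ :=
  f.d * v.1 + f.e * v.2

open Classical in
/-- The constrained Minkowski sum: the multiset of all `p + q`, one for each pair of an element
`p` of `P` and an element `q` of `Q`, that satisfy both constraints. -/
noncomputable def constrainedSum (P Q : Multiset (ℝ × ℝ)) (L₁ L₂ : LinearConstraint) :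
    Multiset (ℝ × ℝ) :=
  ((P ×ˢ Q).map fun pq => pq.1 + pq.2).filter fun v => L₁.Holds v ∧ L₂.Holds v

/-- `v` is the `k`-th largest element of the multiset `M` (`k = 1, 2, …`), that is, the `k`-th
entry when `M` is listed, with multiplicities, in nonincreasing order. -/
def IsKthLargest (M : Multiset ℝ) (k : ℕ) (v : ℝ) : Prop :=
  1 ≤ k ∧ (M.sort (· ≥ ·))[k - 1]? = some v

/-- The initial memory: word variable `0` holds the number of points, word variable `1` holds
`k`, real arrays `0, 1, 2, 3` hold the coordinates of the points, real array `4` holds the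
coefficients of the constraints and of the objective; everything else is `0`. -/
noncomputable def input (P Q : List (ℝ × ℝ)) (L₁ L₂ : LinearConstraint) (f : LinearObjective)
    (k : ℕ) : RealRAM.State where
  w x := [P.length, k].getD x 0
  wa _ _ := 0
  r _ := 0
  ra a i :=
    match a with
    | 0 => (P.getD i (0, 0)).1
    | 1 => (P.getD i (0, 0)).2
    | 2 => (Q.getD i (0, 0)).1
    | 3 => (Q.getD i (0, 0)).2
    | 4 => [L₁.a, L₁.b, L₁.c, L₂.a, L₂.b, L₂.c, f.d, f.e].getD i 0
    | _ => 0

end MinkowskiSelection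

-- The objective is linear, so the values `f(p) + f(q)` form an `n × n` matrix. Once `Q` is sorted
-- by `f`, every row is nondecreasing. The answer `v` is characterized by thresholds
-- (`exists_isKthLargest`): at least `k` feasible pairs have value `≥ t` exactly when `t ≤ v`. Hence
-- a routine that counts feasible pairs of value `≥ t` tells on which side of `t` the answer lies.
--
-- The search keeps a candidate interval in each row. Its pivot `t` is the median of the row
-- medians, weighted by interval lengths. After the count, the rows whose median lies on the wrong
-- side of `t` lose at least half of their interval, and these rows carry at least half of the total
-- length. So each round removes a quarter of all candidates (`four_mul_shrunk_le`), and `O(log n)`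
-- rounds suffice (`rounds_lt`). Pivots reached by `k` pairs are recorded, because discarding a
-- median may discard `v` itself (`run_round`).
--
-- The count concerns three half-planes: `L₁`, `L₂` and `f ≥ t`. For two half-planes, each
-- constraint on `p + q` reads `keyQ ≤ keyP`, and pairs in order for both keys are counted by two
-- stable merge sorts, the second counting non-inversions (`Sorted.sum_good`, `PairCount.run_prog`).
-- For three, the normals in the plane are linearly dependent, so a combination of the three slacks
-- is constant and one of the eight truth patterns never occurs. Inclusion-exclusion then recovers
-- the triple count from the single and double counts (`combine_eq_of_dependent`). A count costs
-- `O(n log n)`, so the total is `O(n log² n)`.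
--
-- Programs are verified by a Hoare-style predicate `Run` with a time bound. Loops use `Run.loop`,
-- loop-free code uses weakest preconditions, and untouched memory is handled by `Frame`.

infixr:60 " ;; " => RealRAM.Program.seq

namespace RealRAM

/-! ## A program logic with time bounds -/

def Program.modW (x : ℕ) : Program → Bool
  | .setW y _ => y == x
  | .seq p q => p.modW x || q.modW x
  | .branch _ p q => p.modW x || q.modW x
  | .loop _ p => p.modW x
  | _ => false

def Program.modWA (x : ℕ) : Program → Bool
  | .putW y _ _ => y == x
  | .seq p q => p.modWA x || q.modWA x
  | .branch _ p q => p.modWA x || q.modWA x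
  | .loop _ p => p.modWA x
  | _ => false

def Program.modR (x : ℕ) : Program → Bool
  | .setR y _ => y == x
  | .seq p q => p.modR x || q.modR x
  | .branch _ p q => p.modR x || q.modR x
  | .loop _ p => p.modR x
  | _ => false

def Program.modRA (x : ℕ) : Program → Bool
  | .putR y _ _ => y == x
  | .seq p q => p.modRA x || q.modRA x
  | .branch _ p q => p.modRA x || q.modRA x
  | .loop _ p => p.modRA x
  | _ => false

/-- `s'` agrees with `s` on all variables and arrays that `p` does not assign to. -/
structure Frame (p : Program) (s s' : State) : Prop where
  w : ∀ x, p.modW x = false → s'.w x = s.w x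
  wa : ∀ x, p.modWA x = false → s'.wa x = s.wa x
  r : ∀ x, p.modR x = false → s'.r x = s.r x
  ra : ∀ x, p.modRA x = false → s'.ra x = s.ra x

theorem Frame.refl (p : Program) (s : State) : Frame p s s :=
  ⟨fun _ _ => rfl, fun _ _ => rfl, fun _ _ => rfl, fun _ _ => rfl⟩

theorem Frame.trans {p : Program} {s₁ s₂ s₃ : State} (h : Frame p s₁ s₂) (g : Frame p s₂ s₃) :
    Frame p s₁ s₃ :=
  ⟨fun x hx => (g.w x hx).trans (h.w x hx), fun x hx => (g.wa x hx).trans (h.wa x hx),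
    fun x hx => (g.r x hx).trans (h.r x hx), fun x hx => (g.ra x hx).trans (h.ra x hx)⟩

theorem Frame.mono {p q : Program} {s s' : State} (h : Frame p s s')
    (hw : ∀ x, q.modW x = false → p.modW x = false)
    (hwa : ∀ x, q.modWA x = false → p.modWA x = false)
    (hr : ∀ x, q.modR x = false → p.modR x = false)
    (hra : ∀ x, q.modRA x = false → p.modRA x = false) : Frame q s s' :=
  ⟨fun x hx => h.w x (hw x hx), fun x hx => h.wa x (hwa x hx), fun x hx => h.r x (hr x hx),
    fun x hx => h.ra x (hra x hx)⟩

/-- `modW` and its companions compute on the program text, so on a concrete program each use of the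
frame is closed by `rfl`. -/
theorem Exec.frame {W : ℕ} {p : Program} {s s' : State} {t : ℕ} (h : Exec W p s s' t) :
    Frame p s s' := by
  induction h with
  | skip s => exact Frame.refl _ _
  | setW s x e he =>
    refine ⟨fun y hy => ?_, fun _ _ => rfl, fun _ _ => rfl, fun _ _ => rfl⟩
    simp only [Program.modW, beq_eq_false_iff_ne] at hy
    exact Function.update_of_ne (Ne.symm hy) _ _
  | putW s a i e hi he =>
    refine ⟨fun _ _ => rfl, fun y hy => ?_, fun _ _ => rfl, fun _ _ => rfl⟩
    simp only [Program.modWA, beq_eq_false_iff_ne] at hy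
    exact Function.update_of_ne (Ne.symm hy) _ _
  | setR s x e =>
    refine ⟨fun _ _ => rfl, fun _ _ => rfl, fun y hy => ?_, fun _ _ => rfl⟩
    simp only [Program.modR, beq_eq_false_iff_ne] at hy
    exact Function.update_of_ne (Ne.symm hy) _ _
  | putR s a i e hi =>
    refine ⟨fun _ _ => rfl, fun _ _ => rfl, fun _ _ => rfl, fun y hy => ?_⟩
    simp only [Program.modRA, beq_eq_false_iff_ne] at hy
    exact Function.update_of_ne (Ne.symm hy) _ _
  | seq _ _ ih₁ ih₂ =>
    refine (ih₁.mono ?_ ?_ ?_ ?_).trans (ih₂.mono ?_ ?_ ?_ ?_) <;> intro x hx <;>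
      simp_all [Program.modW, Program.modWA, Program.modR, Program.modRA]
  | branchTrue _ _ ih | branchFalse _ _ ih =>
    refine ih.mono ?_ ?_ ?_ ?_ <;> intro x hx <;>
      simp_all [Program.modW, Program.modWA, Program.modR, Program.modRA]
  | loopDone _ => exact Frame.refl _ _
  | loopStep _ _ _ ih₁ ih₂ =>
    exact (ih₁.mono (q := .loop _ _) (fun _ h => h) (fun _ h => h) (fun _ h => h)
      (fun _ h => h)).trans ih₂

/-- From `s`, the program `p` halts within `T` steps in a state that satisfies `Q`. -/
def Run (W : ℕ) (p : Program) (s : State) (T : ℕ) (Q : State → Prop) : Prop :=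
  ∃ s' t, Exec W p s s' t ∧ t ≤ T ∧ Q s'

variable {W : ℕ} {p q : Program} {s : State} {b : BExp} {Q R : State → Prop} {T T₁ T₂ : ℕ}

theorem Run.mono (h : Run W p s T₁ R) (hT : T₁ ≤ T)
    (hQ : ∀ s', Frame p s s' → R s' → Q s') : Run W p s T Q := by
  obtain ⟨s', t, he, ht, hr⟩ := h
  exact ⟨s', t, he, ht.trans hT, hQ s' he.frame hr⟩

theorem Run.seq (h : Run W p s T₁ R)
    (h' : ∀ s', Frame p s s' → R s' → Run W q s' T₂ Q) : Run W (p ;; q) s (T₁ + T₂) Q := by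
  obtain ⟨s₁, t₁, he₁, ht₁, hr⟩ := h
  obtain ⟨s₂, t₂, he₂, ht₂, hq⟩ := h' s₁ he₁.frame hr
  exact ⟨s₂, t₁ + t₂, .seq he₁ he₂, by omega, hq⟩

theorem Run.branch (h₁ : b.Holds s → Run W p s T Q) (h₂ : ¬ b.Holds s → Run W q s T Q) :
    Run W (.branch b p q) s (b.cost + T + 1) Q := by
  by_cases hb : b.Holds s
  · obtain ⟨s', t, he, ht, hq⟩ := h₁ hb
    exact ⟨s', _, .branchTrue hb he, by omega, hq⟩
  · obtain ⟨s', t, he, ht, hq⟩ := h₂ hb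
    exact ⟨s', _, .branchFalse hb he, by omega, hq⟩

/-- The invariant is indexed by the number of completed iterations. Together with the guard it must
force `i < N`, which gives termination and the time bound at once, by induction on a bound for `N -
i`. -/
theorem Run.loop (N C : ℕ) (I : ℕ → State → Prop)
    (hI : ∀ i s', Frame p s s' → I i s' → b.Holds s' → i < N ∧ Run W p s' C (I (i + 1)))
    (hQ : ∀ i s', Frame p s s' → I i s' → ¬ b.Holds s' → Q s') (h0 : I 0 s) :
    Run W (.loop b p) s (N * (C + b.cost + 1) + b.cost + 1) Q := by
  suffices H : ∀ d i s', N - i ≤ d → Frame p s s' → I i s' →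
      Run W (.loop b p) s' (d * (C + b.cost + 1) + b.cost + 1) Q from
    H N 0 s (by omega) (Frame.refl _ _) h0
  intro d
  induction d with
  | zero =>
    intro i s' hd hf hi
    by_cases hb : b.Holds s'
    · have := (hI i s' hf hi hb).1
      omega
    · exact ⟨s', _, .loopDone hb, by omega, hQ i s' hf hi hb⟩
  | succ d ih =>
    intro i s' hd hf hi
    by_cases hb : b.Holds s'
    · obtain ⟨hiN, s₁, t₁, he₁, ht₁, hi₁⟩ := hI i s' hf hi hb
      obtain ⟨s₂, t₂, he₂, ht₂, hq⟩ := ih (i + 1) s₁ (by omega) (hf.trans he₁.frame) hi₁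
      refine ⟨s₂, _, .loopStep hb he₁ he₂, ?_, hq⟩
      rw [Nat.succ_mul]
      omega
    · exact ⟨s', _, .loopDone hb, by omega, hQ i s' hf hi hb⟩

/-- Weakest preconditions of loop-free programs. -/
def Program.wp (W : ℕ) : Program → (State → Prop) → State → Prop
  | .skip, Q, s => Q s
  | .setW x e, Q, s => e.eval s < W ∧ Q (s.setW x (e.eval s))
  | .putW a i e, Q, s => i.eval s < W ∧ e.eval s < W ∧ Q (s.putW a (i.eval s) (e.eval s))
  | .setR x e, Q, s => Q (s.setR x (e.eval s))
  | .putR a i e, Q, s => i.eval s < W ∧ Q (s.putR a (i.eval s) (e.eval s))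
  | .seq p q, Q, s => p.wp W (q.wp W Q) s
  | .branch b p q, Q, s => (b.Holds s → p.wp W Q s) ∧ (¬ b.Holds s → q.wp W Q s)
  -- Loops are deliberately excluded; they are handled by `Run.loop` only.
  | .loop _ _, _, _ => False

/-- An upper bound for the running time of loop-free programs. -/
def Program.cost : Program → ℕ
  | .skip => 1
  | .setW _ e => e.cost + 1
  | .putW _ i e => i.cost + e.cost + 1
  | .setR _ e => e.cost + 1
  | .putR _ i e => i.cost + e.cost + 1
  | .seq p q => p.cost + q.cost
  -- The sum stands in for the maximum of the two branches; the value `0` for loops is harmless, as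
  -- their `wp` is false.
  | .branch b p q => b.cost + (p.cost + q.cost) + 1
  | .loop _ _ => 0

theorem Run.of_wp (h : p.wp W Q s) (hT : p.cost ≤ T) : Run W p s T Q := by
  suffices H : Run W p s p.cost Q from H.mono hT fun _ _ h => h
  clear hT
  induction p generalizing s Q with
  | skip => exact ⟨_, _, .skip s, le_rfl, h⟩
  | setW x e => exact ⟨_, _, .setW s x e h.1, le_rfl, h.2⟩
  | putW a i e => exact ⟨_, _, .putW s a i e h.1 h.2.1, le_rfl, h.2.2⟩
  | setR x e => exact ⟨_, _, .setR s x e, le_rfl, h⟩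
  | putR a i e => exact ⟨_, _, .putR s a i e h.1, le_rfl, h.2⟩
  | seq p q ihp ihq => exact (ihp h).seq fun s' _ hs' => ihq hs'
  | branch b p q ihp ihq =>
    exact Run.branch (fun hb => (ihp (h.1 hb)).mono (by omega) fun _ _ h => h)
      (fun hb => (ihq (h.2 hb)).mono (by omega) fun _ _ h => h)
  | loop b p => exact h.elim

/-! ### Reading the memory after one assignment. -/

section Memory

variable (s : State) (x y a c i j v : ℕ) (u : ℝ)

theorem State.setW_w : (s.setW x v).w y = if y = x then v else s.w y := by
  simp [State.setW, Function.update_apply]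

theorem State.setW_wa : (s.setW x v).wa = s.wa := rfl

theorem State.setW_r : (s.setW x v).r = s.r := rfl

theorem State.setW_ra : (s.setW x v).ra = s.ra := rfl

theorem State.putW_w : (s.putW a i v).w = s.w := rfl

theorem State.putW_wa :
    (s.putW a i v).wa c j = if c = a then (if j = i then v else s.wa a j) else s.wa c j := by
  simp only [State.putW, Function.update_apply]
  split_ifs <;> simp_all

theorem State.putW_r : (s.putW a i v).r = s.r := rfl

theorem State.putW_ra : (s.putW a i v).ra = s.ra := rfl

theorem State.setR_w : (s.setR x u).w = s.w := rfl

theorem State.setR_wa : (s.setR x u).wa = s.wa := rfl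

theorem State.setR_r : (s.setR x u).r y = if y = x then u else s.r y := by
  simp [State.setR, Function.update_apply]

theorem State.setR_ra : (s.setR x u).ra = s.ra := rfl

theorem State.putR_w : (s.putR a i u).w = s.w := rfl

theorem State.putR_wa : (s.putR a i u).wa = s.wa := rfl

theorem State.putR_r : (s.putR a i u).r = s.r := rfl

theorem State.putR_ra :
    (s.putR a i u).ra c j = if c = a then (if j = i then u else s.ra a j) else s.ra c j := by
  simp only [State.putR, Function.update_apply]
  split_ifs <;> simp_all

end Memory

attribute [simp] State.setW_w State.setW_wa State.setW_r State.setW_ra State.putW_w State.putW_wa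
  State.putW_r State.putW_ra State.setR_w State.setR_wa State.setR_r State.setR_ra State.putR_w
  State.putR_wa State.putR_r State.putR_ra WExp.eval RExp.eval BExp.Holds Program.wp

end RealRAM

namespace RealRAM

/-! ## Stable merge sort that counts pairs: the combinatorics -/

namespace MergeSort

/-- The order produced by a stable sort of the items by the keys `K`. -/
def Before (K : ℕ → ℝ) (pos : ℕ → ℕ) (a b : ℕ) : Prop :=
  K a < K b ∨ K a = K b ∧ pos a < pos b

variable {K : ℕ → ℝ} {pos : ℕ → ℕ}

theorem Before.trans {a b c : ℕ} (h : Before K pos a b) (g : Before K pos b c) :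
    Before K pos a c := by
  rcases h with h | ⟨h, h'⟩ <;> rcases g with g | ⟨g, g'⟩
  · exact .inl (h.trans g)
  · exact .inl (g ▸ h)
  · exact .inl (h ▸ g)
  · exact .inr ⟨h.trans g, h'.trans g'⟩

theorem Before.ne {a b : ℕ} (h : Before K pos a b) : a ≠ b := by
  rintro rfl
  rcases h with h | ⟨_, h⟩
  · exact lt_irrefl _ h
  · exact lt_irrefl _ h

/-- Blocks are named by an explicit index `c` instead of `x / w`, which leaves linear goals for
`omega`; this lemma identifies two names of one block. -/
theorem block_unique {c c' w x : ℕ} (h₁ : c * w ≤ x) (h₂ : x < c * w + w) (h₃ : c' * w ≤ x)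
    (h₄ : x < c' * w + w) : c = c' := by
  rcases lt_trichotomy c c' with h | h | h
  · have := Nat.mul_le_mul_right w (Nat.succ_le_of_lt h)
    rw [Nat.succ_mul] at this
    omega
  · exact h
  · have := Nat.mul_le_mul_right w (Nat.succ_le_of_lt h)
    rw [Nat.succ_mul] at this
    omega

/-- The first `o` entries of `A` are entries of `A₀`, permuted inside the blocks of width `w`, and
each block is sorted. Here `pos` is the inverse of `A₀` on the first `m` entries. -/
structure BlockSorted (K : ℕ → ℝ) (pos A₀ : ℕ → ℕ) (m o w : ℕ) (A : ℕ → ℕ) : Prop where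
  mem : ∀ x < o, pos (A x) < m
  img : ∀ x < o, A₀ (pos (A x)) = A x
  block : ∀ x < o, ∀ c, c * w ≤ x → x < c * w + w → c * w ≤ pos (A x) ∧ pos (A x) < c * w + w
  sorted : ∀ x y c, c * w ≤ x → x < y → y < c * w + w → y < o → Before K pos (A x) (A y)

variable {A₀ A B B' : ℕ → ℕ} {m o w : ℕ}

theorem BlockSorted.extend (h : BlockSorted K pos A₀ m o w B) (hlt : ∀ x < o, B' x = B x)
    (hmem : pos (B' o) < m) (himg : A₀ (pos (B' o)) = B' o)
    (hblock : ∀ c, c * w ≤ o → o < c * w + w → c * w ≤ pos (B' o) ∧ pos (B' o) < c * w + w)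
    (hsorted : ∀ x c, c * w ≤ x → x < o → o < c * w + w → Before K pos (B x) (B' o)) :
    BlockSorted K pos A₀ m (o + 1) w B' where
  mem x hx := by
    rcases Nat.lt_succ_iff_lt_or_eq.1 hx with hx | rfl
    · rw [hlt x hx]; exact h.mem x hx
    · exact hmem
  img x hx := by
    rcases Nat.lt_succ_iff_lt_or_eq.1 hx with hx | rfl
    · rw [hlt x hx]; exact h.img x hx
    · exact himg
  block x hx := by
    rcases Nat.lt_succ_iff_lt_or_eq.1 hx with hx | rfl
    · rw [hlt x hx]; exact h.block x hx
    · exact hblock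
  sorted x y c h₁ h₂ h₃ hy := by
    rcases Nat.lt_succ_iff_lt_or_eq.1 hy with hy | rfl
    · rw [hlt x (h₂.trans hy), hlt y hy]; exact h.sorted x y c h₁ h₂ h₃ hy
    · rw [hlt x h₂]; exact hsorted x c h₁ h₂ h₃

/-- The map `x ↦ pos (A x)` is injective on the first `m` indices: a coincidence would put both
entries in one block, where the strict order `Before` separates them. Hence `A` is a permutation of
`A₀` and sums over items do not change. -/
theorem BlockSorted.sum_eq (h : BlockSorted K pos A₀ m m w A) (hw : 0 < w)
    (f : ℕ → ℕ) : ∑ x ∈ Finset.range m, f (A x) = ∑ x ∈ Finset.range m, f (A₀ x) := by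
  have hmaps : ∀ x ∈ Finset.range m, pos (A x) ∈ Finset.range m := fun x hx =>
    Finset.mem_range.2 (h.mem x (Finset.mem_range.1 hx))
  have aux : ∀ x y, x < y → y < m → pos (A x) ≠ pos (A y) := by
    intro x y hxy hy he
    have hA : A x = A y := by rw [← h.img x (hxy.trans hy), he, h.img y hy]
    have h₁ := Nat.div_mul_le_self x w
    have h₂ := Nat.lt_div_mul_add (a := x) hw
    have h₃ := Nat.div_mul_le_self y w
    have h₄ := Nat.lt_div_mul_add (a := y) hw
    have b₁ := h.block x (hxy.trans hy) _ h₁ h₂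
    have b₂ := h.block y hy _ h₃ h₄
    have := block_unique b₁.1 b₁.2 (he ▸ b₂.1) (he ▸ b₂.2)
    exact (h.sorted x y (x / w) h₁ hxy (this ▸ h₄) hy).ne hA
  have hinj : Set.InjOn (fun x => pos (A x)) (Finset.range m : Set ℕ) := by
    intro x hx y hy he
    simp only [Finset.coe_range, Set.mem_Iio] at hx hy
    rcases lt_trichotomy x y with hl | hl | hl
    · exact absurd he (aux x y hl hy)
    · exact hl
    · exact absurd he.symm (aux y x hl hx)
  refine Finset.sum_nbij (fun x => pos (A x)) hmaps hinj ?_ ?_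
  · exact Finset.surjOn_of_injOn_of_card_le _ hmaps hinj le_rfl
  · intro x hx
    rw [h.img x (Finset.mem_range.1 hx)]

/-- The position of a merge of two adjacent sorted blocks of width `w`. The block number `c` of
width `2 * w` is being written: its halves `[c * (2 * w), le)` and `[le, re)` have been consumed up
to `i` and `j`, and `ql` of the consumed items of the left half are less than `n`. -/
structure Merging (K : ℕ → ℝ) (pos : ℕ → ℕ) (n m w c : ℕ) (A B : ℕ → ℕ)
    (o i le j re ql : ℕ) : Prop where
  hle : le = min (c * (2 * w) + w) m
  hre : re = min (c * (2 * w) + 2 * w) m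
  i_ge : c * (2 * w) ≤ i
  i_le : i ≤ le
  j_ge : le ≤ j
  j_le : j ≤ re
  add : i + j = o + le
  left : ∀ x, c * (2 * w) ≤ x → x < i → j < re → Before K pos (A x) (A j)
  right : ∀ x, le ≤ x → x < j → i < le → Before K pos (A x) (A i)
  out : ∀ x, c * (2 * w) ≤ x → x < o →
    ∃ y, (c * (2 * w) ≤ y ∧ y < i ∨ le ≤ y ∧ y < j) ∧ B x = A y
  ql_eq : ql = ((Finset.Ico (c * (2 * w)) i).filter (A · < n)).card

variable {n c i le j re ql : ℕ}

theorem BlockSorted.block_left (hA : BlockSorted K pos A₀ m m w A) {x : ℕ} (hx : x < m)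
    (h₁ : c * (2 * w) ≤ x) (h₂ : x < c * (2 * w) + w) :
    c * (2 * w) ≤ pos (A x) ∧ pos (A x) < c * (2 * w) + w := by
  have e : (2 * c) * w = c * (2 * w) := by ring
  have := hA.block x hx (2 * c)
  rw [e] at this
  exact this h₁ h₂

theorem BlockSorted.block_right (hA : BlockSorted K pos A₀ m m w A) {x : ℕ} (hx : x < m)
    (h₁ : c * (2 * w) + w ≤ x) (h₂ : x < c * (2 * w) + 2 * w) :
    c * (2 * w) + w ≤ pos (A x) ∧ pos (A x) < c * (2 * w) + 2 * w := by
  have e : (2 * c + 1) * w = c * (2 * w) + w := by ring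
  have := hA.block x hx (2 * c + 1)
  rw [e] at this
  have := this h₁ (by omega)
  omega

theorem BlockSorted.sorted_left (hA : BlockSorted K pos A₀ m m w A) {x y : ℕ} (hy : y < m)
    (h₁ : c * (2 * w) ≤ x) (hxy : x < y) (h₂ : y < c * (2 * w) + w) :
    Before K pos (A x) (A y) := by
  have e : (2 * c) * w = c * (2 * w) := by ring
  have := hA.sorted x y (2 * c)
  rw [e] at this
  exact this h₁ hxy h₂ hy

theorem BlockSorted.sorted_right (hA : BlockSorted K pos A₀ m m w A) {x y : ℕ} (hy : y < m)
    (h₁ : c * (2 * w) + w ≤ x) (hxy : x < y) (h₂ : y < c * (2 * w) + 2 * w) :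
    Before K pos (A x) (A y) := by
  have e : (2 * c + 1) * w = c * (2 * w) + w := by ring
  have := hA.sorted x y (2 * c + 1)
  rw [e] at this
  exact this h₁ hxy (by omega) hy

theorem Merging.take_left (h : Merging K pos n m w c A B o i le j re ql)
    (hA : BlockSorted K pos A₀ m m w A) (hi : i < le) (hj : j < re → Before K pos (A i) (A j))
    (hlt : ∀ x < o, B' x = B x) (ho : B' o = A i) :
    Merging K pos n m w c A B' (o + 1) (i + 1) le j re (if A i < n then ql + 1 else ql) := by
  have hle := h.hle
  have hre := h.hre
  have := h.i_ge
  refine ⟨h.hle, h.hre, by omega, hi, h.j_ge, h.j_le, by have := h.add; omega, ?_, ?_, ?_, ?_⟩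
  · intro x h₁ h₂ h₃
    rcases Nat.lt_succ_iff_lt_or_eq.1 h₂ with h₂ | rfl
    · exact h.left x h₁ h₂ h₃
    · exact hj h₃
  · intro x h₁ h₂ h₃
    exact (h.right x h₁ h₂ hi).trans (hA.sorted_left (c := c) (by omega) h.i_ge (by omega) (by omega))
  · intro x h₁ h₂
    rcases Nat.lt_succ_iff_lt_or_eq.1 h₂ with h₂ | rfl
    · obtain ⟨y, hy, e⟩ := h.out x h₁ h₂
      exact ⟨y, by omega, (hlt x h₂).trans e⟩
    · exact ⟨i, by omega, ho⟩
  · rw [← Finset.insert_Ico_right_eq_Ico_add_one h.i_ge, Finset.filter_insert, h.ql_eq]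
    split_ifs
    · rw [Finset.card_insert_of_notMem (by simp)]
    · rfl

theorem Merging.take_right (h : Merging K pos n m w c A B o i le j re ql)
    (hA : BlockSorted K pos A₀ m m w A) (hj : j < re) (hi : i < le → Before K pos (A j) (A i))
    (hlt : ∀ x < o, B' x = B x) (ho : B' o = A j) :
    Merging K pos n m w c A B' (o + 1) i le (j + 1) re ql := by
  have hle := h.hle
  have hre := h.hre
  have := h.j_ge
  refine ⟨h.hle, h.hre, h.i_ge, h.i_le, by omega, hj, by have := h.add; omega, ?_, ?_, ?_,
    h.ql_eq⟩
  · intro x h₁ h₂ h₃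
    exact (h.left x h₁ h₂ hj).trans
      (hA.sorted_right (c := c) (by omega) (by omega) (by omega) (by omega))
  · intro x h₁ h₂ h₃
    rcases Nat.lt_succ_iff_lt_or_eq.1 h₂ with h₂ | rfl
    · exact h.right x h₁ h₂ h₃
    · exact hi h₃
  · intro x h₁ h₂
    rcases Nat.lt_succ_iff_lt_or_eq.1 h₂ with h₂ | rfl
    · obtain ⟨y, hy, e⟩ := h.out x h₁ h₂
      exact ⟨y, by omega, (hlt x h₂).trans e⟩
    · exact ⟨j, by omega, ho⟩

/-- Earlier outputs of the block came either from the left half, and precede `A i` because that half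
is sorted, or from the right half, and precede it by `right`. -/
theorem Merging.extend_left (h : Merging K pos n m w c A B o i le j re ql)
    (hA : BlockSorted K pos A₀ m m w A) (hB : BlockSorted K pos A₀ m o (2 * w) B) (hi : i < le)
    (hlt : ∀ x < o, B' x = B x) (ho : B' o = A i) :
    BlockSorted K pos A₀ m (o + 1) (2 * w) B' := by
  have hle := h.hle
  have hre := h.hre
  have h₁ := h.i_ge
  have h₂ := h.j_ge
  have h₃ := h.j_le
  have h₄ := h.add
  have hb := hA.block_left (c := c) (x := i) (by omega) h₁ (by omega)
  refine hB.extend hlt ?_ ?_ ?_ ?_ <;> rw [ho]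
  · exact hA.mem i (by omega)
  · exact hA.img i (by omega)
  · intro c' h₅ h₆
    obtain rfl := block_unique (c := c) (c' := c') (w := 2 * w) (x := o) (by omega) (by omega) h₅ h₆
    omega
  · intro x c' h₅ h₆ h₇
    obtain rfl := block_unique (c := c) (c' := c') (w := 2 * w) (x := o) (by omega) (by omega)
      (by omega) h₇
    obtain ⟨y, hy | hy, e⟩ := h.out x h₅ h₆ <;> rw [e]
    · exact hA.sorted_left (c := c) (by omega) hy.1 hy.2 (by omega)
    · exact h.right y hy.1 hy.2 hi

theorem Merging.extend_right (h : Merging K pos n m w c A B o i le j re ql)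
    (hA : BlockSorted K pos A₀ m m w A) (hB : BlockSorted K pos A₀ m o (2 * w) B) (hj : j < re)
    (hlt : ∀ x < o, B' x = B x) (ho : B' o = A j) :
    BlockSorted K pos A₀ m (o + 1) (2 * w) B' := by
  have hle := h.hle
  have hre := h.hre
  have h₁ := h.i_ge
  have h₂ := h.j_ge
  have h₃ := h.i_le
  have h₄ := h.add
  have hb := hA.block_right (c := c) (x := j) (by omega) (by omega) (by omega)
  refine hB.extend hlt ?_ ?_ ?_ ?_ <;> rw [ho]
  · exact hA.mem j (by omega)
  · exact hA.img j (by omega)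
  · intro c' h₅ h₆
    obtain rfl := block_unique (c := c) (c' := c') (w := 2 * w) (x := o) (by omega) (by omega) h₅ h₆
    omega
  · intro x c' h₅ h₆ h₇
    obtain rfl := block_unique (c := c) (c' := c') (w := 2 * w) (x := o) (by omega) (by omega)
      (by omega) h₇
    obtain ⟨y, hy | hy, e⟩ := h.out x h₅ h₆ <;> rw [e]
    · exact h.left y hy.1 hy.2 hj
    · exact hA.sorted_right (c := c) (by omega) (by omega) hy.2 (by omega)

/-- `a` is one of the first `n` items, `b` is not, and the key of `a` is at most that of `b`. -/
def Good (K : ℕ → ℝ) (n a b : ℕ) : Prop := a < n ∧ n ≤ b ∧ K a ≤ K b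

open Classical in
/-- The number of the good pairs `(a, b)` with `a` to the left of `b` in `b`'s block. -/
noncomputable def blockCount (K : ℕ → ℝ) (pos A₀ : ℕ → ℕ) (n m w b : ℕ) : ℕ :=
  ∑ x ∈ Finset.range m,
    if Good K n (A₀ x) b ∧ ∃ c, c * w ≤ pos (A₀ x) ∧ pos (A₀ x) < pos b ∧
      pos b < c * w + w then 1 else 0

open Classical in
/-- The number of the good pairs `(a, b)` with `b` in the right half of its block of width `2 * w`
and `a` in the left half. -/
noncomputable def crossCount (K : ℕ → ℝ) (pos A₀ : ℕ → ℕ) (n m w b : ℕ) : ℕ :=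
  ∑ x ∈ Finset.range m,
    if Good K n (A₀ x) b ∧ ∃ c, c * (2 * w) ≤ pos (A₀ x) ∧
      pos (A₀ x) < c * (2 * w) + w ∧ c * (2 * w) + w ≤ pos b ∧ pos b < c * (2 * w) + 2 * w then 1 else 0

/-- A pair in order inside a block of width `2 * w` either lies in one half or has `a` in the left
and `b` in the right half, never both. So a merge only has to add the crossing pairs. -/
theorem blockCount_two_mul (hw : 0 < w) (b : ℕ) :
    blockCount K pos A₀ n m (2 * w) b =
      blockCount K pos A₀ n m w b + crossCount K pos A₀ n m w b := by
  classical
  unfold blockCount crossCount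
  rw [← Finset.sum_add_distrib]
  refine Finset.sum_congr rfl fun x _ => ?_
  by_cases hg : Good K n (A₀ x) b
  swap
  · simp [hg]
  simp only [hg, true_and]
  generalize pos (A₀ x) = x
  have e (c : ℕ) : (2 * c) * w = c * (2 * w) := by ring
  have e' (c : ℕ) : (2 * c + 1) * w = c * (2 * w) + w := by ring
  by_cases h₁ : ∃ c, c * w ≤ x ∧ x < pos b ∧ pos b < c * w + w
  · have h₂ : ¬ ∃ c, c * (2 * w) ≤ x ∧ x < c * (2 * w) + w ∧ c * (2 * w) + w ≤ pos b ∧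
        pos b < c * (2 * w) + 2 * w := by
      rintro ⟨c, g₁, g₂, g₃, g₄⟩
      obtain ⟨d, k₁, k₂, k₃⟩ := h₁
      have := e c
      have := e' c
      have u₁ := block_unique (c := d) (c' := 2 * c) (w := w) (x := x) k₁ (by omega) (by omega)
        (by omega)
      have u₂ := block_unique (c := d) (c' := 2 * c + 1) (w := w) (x := pos b) (by omega) k₃
        (by omega) (by omega)
      omega
    have h₃ : ∃ c, c * (2 * w) ≤ x ∧ x < pos b ∧ pos b < c * (2 * w) + 2 * w := by
      obtain ⟨d, k₁, k₂, k₃⟩ := h₁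
      obtain ⟨c, rfl | rfl⟩ := Nat.even_or_odd' d
      · rw [e] at k₁ k₃
        exact ⟨c, by omega⟩
      · rw [e'] at k₁ k₃
        exact ⟨c, by omega⟩
    rw [if_pos h₁, if_neg h₂, if_pos h₃]
  · rw [if_neg h₁, zero_add]
    refine if_congr ⟨?_, ?_⟩ rfl rfl
    · rintro ⟨c, k₁, k₂, k₃⟩
      push Not at h₁
      have g₁ := h₁ (2 * c)
      have g₂ := h₁ (2 * c + 1)
      rw [e] at g₁
      rw [e'] at g₂
      exact ⟨c, by omega⟩
    · rintro ⟨c, k₁, k₂, k₃, k₄⟩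
      exact ⟨c, by omega⟩

theorem Merging.crossCount_left (h : Merging K pos n m w c A B o i le j re ql)
    (hA : BlockSorted K pos A₀ m m w A) (hi : i < le) :
    crossCount K pos A₀ n m w (A i) = 0 := by
  have hle := h.hle
  have h₁ := h.i_ge
  have hb := hA.block_left (c := c) (x := i) (by omega) h₁ (by omega)
  refine Finset.sum_eq_zero fun x _ => if_neg ?_
  rintro ⟨_, d, g₁, g₂, g₃, g₄⟩
  obtain rfl := block_unique (c := c) (c' := d) (w := 2 * w) (x := pos (A i)) (by omega) (by omega)
    (by omega) g₄
  omega

/-- When `A j` is output, the consumed items of the left half are exactly those with key at most `K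
(A j)`: the consumed ones precede `A j`, and the remaining ones have keys at least `K (A i) > K (A
j)`, because the left half wins ties. -/
theorem Merging.crossCount_right (h : Merging K pos n m w c A B o i le j re ql)
    (hA : BlockSorted K pos A₀ m m w A) (hw : 0 < w) (hj : j < re)
    (hi : i < le → K (A j) < K (A i)) :
    crossCount K pos A₀ n m w (A j) = if n ≤ A j then ql else 0 := by
  classical
  have hle := h.hle
  have hre := h.hre
  have h₁ := h.j_ge
  have h₂ := h.i_le
  have h₃ := h.i_ge
  have hb := hA.block_right (c := c) (x := j) (by omega) (by omega) (by omega)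
  have hs : crossCount K pos A₀ n m w (A j) = ∑ x ∈ Finset.range m,
      if Good K n (A x) (A j) ∧ ∃ d, d * (2 * w) ≤ pos (A x) ∧ pos (A x) < d * (2 * w) + w ∧
        d * (2 * w) + w ≤ pos (A j) ∧ pos (A j) < d * (2 * w) + 2 * w then 1 else 0 :=
    (hA.sum_eq hw fun a =>
      if Good K n a (A j) ∧ ∃ d, d * (2 * w) ≤ pos a ∧ pos a < d * (2 * w) + w ∧
        d * (2 * w) + w ≤ pos (A j) ∧ pos (A j) < d * (2 * w) + 2 * w then 1 else 0).symm
  rw [hs, ← Finset.card_filter]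
  split_ifs with hj'
  · rw [h.ql_eq]
    congr 1
    ext x
    rw [Finset.mem_filter, Finset.mem_filter, Finset.mem_range, Finset.mem_Ico]
    simp only [Good]
    constructor
    · rintro ⟨hx, ⟨g₁, g₂, g₃⟩, d, k₁, k₂, k₃, k₄⟩
      obtain rfl := block_unique (c := c) (c' := d) (w := 2 * w) (x := pos (A j)) (by omega)
        (by omega) (by omega) k₄
      have hd₁ := Nat.div_mul_le_self x (2 * w)
      have hd₂ := Nat.lt_div_mul_add (a := x) (b := 2 * w) (by omega)
      -- Sorting so far only permutes inside blocks of width `w`, so `x` and the original position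
      -- of `A x` share the same block of width `2 * w`.
      have e : x / (2 * w) = c := by
        by_cases hx' : x < x / (2 * w) * (2 * w) + w
        · have := hA.block_left (c := x / (2 * w)) hx (by omega) hx'
          exact block_unique (x := pos (A x)) (w := 2 * w) (by omega) (by omega) k₁ (by omega)
        · have := hA.block_right (c := x / (2 * w)) hx (by omega) (by omega)
          exact block_unique (x := pos (A x)) (w := 2 * w) (by omega) (by omega) k₁ (by omega)
      rw [e] at hd₁ hd₂
      have hx' : x < c * (2 * w) + w := by
        by_contra hx'
        have := hA.block_right (c := c) hx (by omega) (by omega)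
        omega
      refine ⟨⟨by omega, ?_⟩, g₁⟩
      by_contra hix
      have hlt : K (A j) < K (A x) := by
        rcases (show i = x ∨ i < x by omega) with rfl | hl
        · exact hi (by omega)
        · refine (hi (by omega)).trans_le ?_
          rcases hA.sorted_left (c := c) hx h₃ hl hx' with hk | hk
          · exact hk.le
          · exact hk.1.le
      exact absurd g₃ (not_le.2 hlt)
    · rintro ⟨⟨k₁, k₂⟩, k₃⟩
      have := hA.block_left (c := c) (x := x) (by omega) k₁ (by omega)
      refine ⟨by omega, ⟨k₃, hj', ?_⟩, c, by omega⟩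
      rcases h.left x k₁ k₂ hj with hk | hk
      · exact hk.le
      · exact hk.1.le
  · simp [Good, hj']

/-- The result of a stable sort of `A₀` by the keys `K`. -/
structure Sorted (K : ℕ → ℝ) (pos A₀ : ℕ → ℕ) (m : ℕ) (A : ℕ → ℕ) : Prop where
  mem : ∀ x < m, pos (A x) < m
  img : ∀ x < m, A₀ (pos (A x)) = A x
  sorted : ∀ x y, x < y → y < m → Before K pos (A x) (A y)

theorem BlockSorted.toSorted (h : BlockSorted K pos A₀ m m w A) (hm : m ≤ w) :
    Sorted K pos A₀ m A :=
  ⟨h.mem, h.img, fun x y hxy hy => h.sorted x y 0 (by omega) hxy (by omega) hy⟩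

theorem Sorted.toBlockSorted (h : Sorted K pos A₀ m A) :
    BlockSorted K pos A₀ m m m A := by
  refine ⟨h.mem, h.img, fun x hx c h₁ h₂ => ?_, fun x y _ _ hxy _ hy => h.sorted x y hxy hy⟩
  obtain rfl := block_unique (c := c) (c' := 0) (w := m) h₁ h₂ (by omega) (by omega)
  have := h.mem x hx
  omega

theorem Sorted.sum_eq (h : Sorted K pos A₀ m A) (f : ℕ → ℕ) :
    ∑ x ∈ Finset.range m, f (A x) = ∑ x ∈ Finset.range m, f (A₀ x) := by
  rcases Nat.eq_zero_or_pos m with rfl | hm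
  · simp
  · exact h.toBlockSorted.sum_eq hm f

theorem blockSorted_one (h : ∀ x < m, pos (A₀ x) = x) : BlockSorted K pos A₀ m m 1 A₀ :=
  ⟨fun x hx => by rwa [h x hx], fun x hx => by rw [h x hx], fun x hx c h₁ h₂ => by
    rw [h x hx]; omega, fun x y c _ _ _ _ => by omega⟩

theorem blockCount_one (b : ℕ) : blockCount K pos A₀ n m 1 b = 0 :=
  Finset.sum_eq_zero fun x _ => if_neg fun ⟨_, c, h⟩ => by omega

open Classical in
theorem blockCount_of_le (hw : m ≤ w) {b : ℕ} (hb : pos b < m) :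
    blockCount K pos A₀ n m w b = ∑ x ∈ Finset.range m,
      if Good K n (A₀ x) b ∧ pos (A₀ x) < pos b then 1 else 0 := by
  refine Finset.sum_congr rfl fun x _ => if_congr (and_congr_right fun _ => ⟨?_, ?_⟩) rfl rfl
  · rintro ⟨c, h⟩
    exact h.2.1
  · exact fun h => ⟨0, by omega⟩

open Classical in
theorem sum_blockCount_le : ∑ y ∈ Finset.range m, blockCount K pos A₀ n m w (A y) ≤ m * m := by
  refine (Finset.sum_le_card_nsmul _ _ m fun y _ => ?_).trans (by simp)
  unfold blockCount
  rw [← Finset.card_filter]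
  exact (Finset.card_filter_le _ _).trans (by simp)

end MergeSort

end RealRAM

namespace RealRAM

/-! ## Stable merge sort that counts pairs: the program -/

namespace MergeSort

/-- Starts the next block: word variables `11`, `12` hold the block width and the output position,
`13`, `14` the heads of the two halves, `15`, `16` their ends, and `17` counts the consumed small
items of the left half. -/
def resetProg : Program :=
  .branch (.wle (.var 16) (.var 12))
    (.setW 13 (.var 12) ;;
      -- With truncated subtraction, `m - (m - x)` is `min x m`; this cuts off the last, possibly
      -- incomplete, block.
      .setW 15 (.sub (.var 10) (.sub (.var 10) (.add (.var 12) (.var 11)))) ;;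
      .setW 14 (.var 15) ;;
      .setW 16 (.sub (.var 10) (.sub (.var 10)
        (.add (.var 12) (.add (.var 11) (.var 11))))) ;;
      .setW 17 (.lit 0))
    .skip

/-- The left head is taken unless the right head exists and has a strictly smaller key. Ties thus go
to the left, which makes the sort stable and the crossing counts exact. -/
def stepProg : Program :=
  .branch
    (.and (.not (.wle (.var 15) (.var 13)))
      (.not (.and (.not (.wle (.var 16) (.var 14)))
        (.not (.rle (.get 5 (.get 0 (.var 13))) (.get 5 (.get 0 (.var 14))))))))
    (.putW 1 (.var 12) (.get 0 (.var 13)) ;;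
      .branch (.wle (.var 0) (.get 0 (.var 13))) .skip (.setW 17 (.add (.var 17) (.lit 1))) ;;
      .setW 13 (.add (.var 13) (.lit 1)) ;; .setW 12 (.add (.var 12) (.lit 1)))
    (.putW 1 (.var 12) (.get 0 (.var 14)) ;;
      .branch (.wle (.var 0) (.get 0 (.var 14))) (.setW 18 (.add (.var 18) (.var 17))) .skip ;;
      .setW 14 (.add (.var 14) (.lit 1)) ;; .setW 12 (.add (.var 12) (.lit 1)))

def mergeLoop : Program :=
  .loop (.not (.wle (.var 10) (.var 12))) (resetProg ;; stepProg)

def copyLoop : Program :=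
  .loop (.not (.wle (.var 10) (.var 12)))
    (.putW 0 (.var 12) (.get 1 (.var 12)) ;; .setW 12 (.add (.var 12) (.lit 1)))

def passProg : Program :=
  -- A block end of `0` makes the first step of the merge loop open block number `0`.
  (.setW 12 (.lit 0) ;; .setW 16 (.lit 0)) ;; mergeLoop ;; .setW 12 (.lit 0) ;; copyLoop ;;
    .setW 11 (.add (.var 11) (.var 11))

/-- Sorts the first `w 10` entries of word array `0` by the keys in real array `5`, and counts in
`w 18` the pairs of an entry below `w 0` and a later entry that is not, with keys in order. -/
def prog : Program :=
  (.setW 18 (.lit 0) ;; .setW 11 (.lit 1)) ;; .loop (.not (.wle (.var 10) (.var 11))) passProg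

variable {K : ℕ → ℝ} {pos A₀ A : ℕ → ℕ} {n m w W : ℕ}

/-- The loop invariant of a merge pass at output position `o`. -/
structure PassInv (K : ℕ → ℝ) (pos A₀ : ℕ → ℕ) (n m w : ℕ) (A : ℕ → ℕ) (o : ℕ) (s : State) :
    Prop where
  pos_eq : s.w 12 = o
  le : o ≤ m
  out : BlockSorted K pos A₀ m o (2 * w) (s.wa 1)
  count : s.w 18 = ∑ y ∈ Finset.range m, blockCount K pos A₀ n m w (A y) +
    ∑ y ∈ Finset.range o, crossCount K pos A₀ n m w (s.wa 1 y)
  boundary : s.w 16 ≤ o → (∃ c, o = c * (2 * w)) ∨ o = m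
  merging : o < s.w 16 → ∃ c,
    Merging K pos n m w c A (s.wa 1) o (s.w 13) (s.w 15) (s.w 14) (s.w 16) (s.w 17)

theorem sum_crossCount_le (o : ℕ) (B : ℕ → ℕ) (ho : o ≤ m) :
    ∑ y ∈ Finset.range o, crossCount K pos A₀ n m w (B y) ≤ m * m := by
  classical
  refine (Finset.sum_le_card_nsmul _ _ m fun y _ => ?_).trans ?_
  · unfold crossCount
    rw [← Finset.card_filter]
    exact (Finset.card_filter_le _ _).trans (by simp)
  · simp only [Finset.card_range, smul_eq_mul]
    exact Nat.mul_le_mul_right m ho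

theorem run_reset {s : State} {o : ℕ} (hm : s.w 10 = m) (hw : 0 < w) (hsw : s.w 11 = w)
    (h : PassInv K pos A₀ n m w A o s) (ho : o < m) (hW : m < W) :
    Run W resetProg s 40 fun s' => PassInv K pos A₀ n m w A o s' ∧ o < s'.w 16 ∧ s'.wa = s.wa := by
  obtain ⟨rfl, h₁, h₂, h₃, h₄, h₅⟩ := h
  refine Run.of_wp ?_ (by decide)
  simp only [resetProg, Program.wp, BExp.Holds, WExp.eval, State.setW_w, State.setW_wa]
  refine ⟨fun hb => ?_, fun hb => ?_⟩
  · simp +decide only [if_true, if_false]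
    rw [hm, hsw]
    refine ⟨by omega, by omega, by omega, by omega, by omega, ?_, by omega, trivial⟩
    obtain ⟨c, hc⟩ := (h₄ hb).resolve_right (by omega)
    constructor
    · simp
    · exact h₁
    · exact h₂
    · simpa using h₃
    · simp
      omega
    · intro _
      refine ⟨c, ?_⟩
      simp
      constructor
      any_goals omega
      simp [hc]
  · exact ⟨⟨rfl, h₁, h₂, h₃, h₄, h₅⟩, by omega, trivial⟩

theorem Merging.boundary {B : ℕ → ℕ} {c o i le j re ql : ℕ}
    (h : Merging K pos n m w c A B o i le j re ql) (ho : re ≤ o) :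
    (∃ c, o = c * (2 * w)) ∨ o = m := by
  have a₂ := h.hre
  have a₄ := h.i_le
  have a₆ := h.j_le
  have a₇ := h.add
  by_cases hm' : re = m
  · right; omega
  · left; exact ⟨c + 1, by rw [Nat.succ_mul]; omega⟩

theorem PassInv.next_left {s s' : State} {o : ℕ}
    (hA : BlockSorted K pos A₀ m m w A)
    (h : PassInv K pos A₀ n m w A o s) (ho : o < s.w 16) (hi : s.w 13 < s.w 15)
    (hj : s.w 14 < s.w 16 → K (A (s.w 13)) ≤ K (A (s.w 14)))
    (e₁ : s'.w 12 = o + 1) (e₂ : s'.w 13 = s.w 13 + 1) (e₃ : s'.w 14 = s.w 14)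
    (e₄ : s'.w 15 = s.w 15) (e₅ : s'.w 16 = s.w 16)
    (e₆ : s'.w 17 = if A (s.w 13) < n then s.w 17 + 1 else s.w 17) (e₇ : s'.w 18 = s.w 18)
    (e₈ : ∀ x, s'.wa 1 x = if x = o then A (s.w 13) else s.wa 1 x) :
    PassInv K pos A₀ n m w A (o + 1) s' := by
  obtain ⟨h₀, h₁, h₂, h₃, h₄, h₅⟩ := h
  obtain ⟨c, hM⟩ := h₅ ho
  have a₁ := hM.hle
  have a₂ := hM.hre
  have a₃ := hM.i_ge
  have a₅ := hM.j_ge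
  have e₉ : ∀ x < o, s'.wa 1 x = s.wa 1 x := fun x hx => by rw [e₈, if_neg hx.ne]
  have e : s'.wa 1 o = A (s.w 13) := by rw [e₈, if_pos rfl]
  -- On equal keys the original positions decide: those of the left half precede those of the right
  -- half.
  have hbef : s.w 14 < s.w 16 → Before K pos (A (s.w 13)) (A (s.w 14)) := fun hlt => by
    rcases (hj hlt).lt_or_eq with hk | hk
    · exact .inl hk
    · have b₁ := hA.block_left (c := c) (x := s.w 13) (by omega) a₃ (by omega)
      have b₂ := hA.block_right (c := c) (x := s.w 14) (by omega) (by omega) (by omega)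
      exact .inr ⟨hk, by omega⟩
  have hM' := hM.take_left hA hi hbef e₉ e
  refine ⟨e₁, by omega, hM.extend_left hA h₂ hi e₉ e, ?_, fun hb => ?_, fun _ => ⟨c, ?_⟩⟩
  · rw [e₇, h₃, Finset.sum_range_succ, e, hM.crossCount_left hA hi, add_zero]
    congr 1
    exact Finset.sum_congr rfl fun x hx => by rw [e₉ x (Finset.mem_range.1 hx)]
  · exact hM'.boundary (by omega)
  · rw [e₂, e₃, e₄, e₅, e₆]
    exact hM'

theorem PassInv.next_right {s s' : State} {o : ℕ} (hw : 0 < w)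
    (hA : BlockSorted K pos A₀ m m w A)
    (h : PassInv K pos A₀ n m w A o s) (ho : o < s.w 16) (hj : s.w 14 < s.w 16)
    (hi : s.w 13 < s.w 15 → K (A (s.w 14)) < K (A (s.w 13)))
    (e₁ : s'.w 12 = o + 1) (e₂ : s'.w 13 = s.w 13) (e₃ : s'.w 14 = s.w 14 + 1)
    (e₄ : s'.w 15 = s.w 15) (e₅ : s'.w 16 = s.w 16) (e₆ : s'.w 17 = s.w 17)
    (e₇ : s'.w 18 = s.w 18 + if n ≤ A (s.w 14) then s.w 17 else 0)
    (e₈ : ∀ x, s'.wa 1 x = if x = o then A (s.w 14) else s.wa 1 x) :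
    PassInv K pos A₀ n m w A (o + 1) s' := by
  obtain ⟨h₀, h₁, h₂, h₃, h₄, h₅⟩ := h
  obtain ⟨c, hM⟩ := h₅ ho
  have a₁ := hM.hle
  have a₂ := hM.hre
  have a₃ := hM.i_ge
  have a₅ := hM.j_ge
  have e₉ : ∀ x < o, s'.wa 1 x = s.wa 1 x := fun x hx => by rw [e₈, if_neg hx.ne]
  have e : s'.wa 1 o = A (s.w 14) := by rw [e₈, if_pos rfl]
  have hM' := hM.take_right hA hj (fun hlt => .inl (hi hlt)) e₉ e
  refine ⟨e₁, by omega, hM.extend_right hA h₂ hj e₉ e, ?_, fun hb => ?_, fun _ => ⟨c, ?_⟩⟩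
  · rw [e₇, h₃, Finset.sum_range_succ, e, hM.crossCount_right hA hw hj hi, add_assoc]
    congr 2
    exact Finset.sum_congr rfl fun x hx => by rw [e₉ x (Finset.mem_range.1 hx)]
  · exact hM'.boundary (by omega)
  · rw [e₂, e₃, e₄, e₅, e₆]
    exact hM'

theorem run_step {s : State} {o : ℕ} (hn : s.w 0 = n) (hw : 0 < w)
    (hK : s.ra 5 = K) (hA : s.wa 0 = A)
    (h : PassInv K pos A₀ n m w A o s) (ho : o < s.w 16) (hW : 2 * m * m + m + 1 < W)
    (hAW : ∀ x < m, A x < W) (hAs : BlockSorted K pos A₀ m m w A) :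
    Run W stepProg s 80 (PassInv K pos A₀ n m w A (o + 1)) := by
  obtain ⟨c, hM⟩ := h.merging ho
  have h₀ := h.pos_eq
  have a₁ := hM.hle
  have a₂ := hM.hre
  have a₃ := hM.i_ge
  have a₄ := hM.i_le
  have a₅ := hM.j_ge
  have a₆ := hM.j_le
  have a₇ := hM.add
  have hql : s.w 17 ≤ m := by
    rw [hM.ql_eq]
    exact (Finset.card_filter_le _ _).trans (by simp; omega)
  have hAi : s.w 13 < s.w 15 → A (s.w 13) < W := fun _ => hAW _ (by omega)
  have hAj : s.w 14 < s.w 16 → A (s.w 14) < W := fun _ => hAW _ (by omega)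
  refine Run.of_wp ?_ (by decide)
  rw [stepProg]
  refine ⟨fun hb => ?_, fun hb => ?_⟩ <;>
    simp only [BExp.Holds, WExp.eval, RExp.eval, hA, hK, not_le] at hb
  · obtain ⟨hi, hb⟩ := hb
    have hj : s.w 14 < s.w 16 → K (A (s.w 13)) ≤ K (A (s.w 14)) := fun hlt =>
      not_lt.1 fun hk => hb ⟨hlt, hk⟩
    have hnext := fun s' => h.next_left (s' := s') hAs ho hi hj
    refine ⟨?_, ?_, fun hc => ⟨?_, ?_, ?_⟩, fun hc => ⟨?_, ?_, ?_, ?_⟩⟩ <;>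
      (try simp [hA, hn] at hc) <;> simp [h₀, hA]
    · omega
    · exact hAi hi
    · omega
    · omega
    · refine hnext _ ?_ ?_ ?_ ?_ ?_ ?_ ?_ ?_ <;> simp [hc]
    · omega
    · omega
    · omega
    · refine hnext _ ?_ ?_ ?_ ?_ ?_ ?_ ?_ ?_ <;> simp [hc]
  · have hj : s.w 14 < s.w 16 := by
      by_contra hj
      exact hb ⟨by omega, fun hk => hj hk.1⟩
    have hi : s.w 13 < s.w 15 → K (A (s.w 14)) < K (A (s.w 13)) := fun hlt => by
      by_contra hk
      exact hb ⟨hlt, fun hk' => hk hk'.2⟩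
    have hcnt : n ≤ A (s.w 14) → s.w 18 + s.w 17 < W := by
      intro hc
      have e := hM.crossCount_right hAs hw hj hi
      rw [if_pos hc] at e
      -- The output array is extended by the item about to be written, so that the general bound
      -- already covers the updated counter and shows that it fits into a word.
      have b₁ := sum_crossCount_le (K := K) (pos := pos) (A₀ := A₀) (n := n) (m := m) (w := w)
        (o + 1) (fun x => if x = o then A (s.w 14) else s.wa 1 x) (by omega)
      rw [Finset.sum_range_succ, if_pos rfl, e, Finset.sum_congr rfl (g := fun x =>
        crossCount K pos A₀ n m w (s.wa 1 x)) fun x hx => by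
          rw [if_neg (Finset.mem_range.1 hx).ne]] at b₁
      have b₂ := sum_blockCount_le (K := K) (pos := pos) (A₀ := A₀) (n := n) (m := m) (w := w)
        (A := A)
      have := h.count
      rw [mul_assoc] at hW
      omega
    have hnext := fun s' => h.next_right (s' := s') hw hAs ho hj hi
    refine ⟨?_, ?_, fun hc => ⟨?_, ?_, ?_, ?_⟩, fun hc => ⟨?_, ?_, ?_⟩⟩ <;>
      (try simp [hA, hn] at hc) <;> simp [h₀, hA]
    · omega
    · exact hAj hj
    · exact hcnt hc
    · omega
    · omega
    · refine hnext _ ?_ ?_ ?_ ?_ ?_ ?_ ?_ ?_ <;> simp [hc]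
    · omega
    · omega
    · refine hnext _ ?_ ?_ ?_ ?_ ?_ ?_ ?_ ?_ <;> simp [hc]

end MergeSort
end RealRAM

namespace RealRAM

namespace MergeSort

variable {K : ℕ → ℝ} {pos A₀ A : ℕ → ℕ} {n m w W : ℕ}

/-! ### Correctness and running time of the sort. -/

theorem run_mergeLoop {s : State} (hm : s.w 10 = m) (hn : s.w 0 = n) (hw : 0 < w)
    (hsw : s.w 11 = w) (hK : s.ra 5 = K) (hA : s.wa 0 = A) (hW : 2 * m * m + m + 1 < W)
    (hAW : ∀ x < m, A x < W) (hAs : BlockSorted K pos A₀ m m w A) (h12 : s.w 12 = 0)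
    (h16 : s.w 16 = 0)
    (h18 : s.w 18 = ∑ y ∈ Finset.range m, blockCount K pos A₀ n m w (A y)) :
    Run W mergeLoop s (m * 130 + 10) fun s' => BlockSorted K pos A₀ m m (2 * w) (s'.wa 1) ∧
      s'.w 18 = ∑ y ∈ Finset.range m, blockCount K pos A₀ n m (2 * w) (s'.wa 1 y) := by
  refine (Run.loop m 120 (fun o s' => PassInv K pos A₀ n m w A o s') ?_ ?_ ?_).mono (by
    simp only [BExp.cost, WExp.cost]; omega) fun _ _ h => h
  · intro o s' hf h hb
    have ho : o < m := by
      have := h.pos_eq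
      simp only [BExp.Holds, WExp.eval, hf.w 10 rfl, hm] at hb
      omega
    refine ⟨ho, (run_reset ((hf.w 10 rfl).trans hm) hw ((hf.w 11 rfl).trans hsw) h ho
      (W := W) (by omega)).seq (T₂ := 80) fun s₁ hf₁ h₁ => ?_⟩
    refine run_step (((hf₁.w 0 rfl).trans (hf.w 0 rfl)).trans hn) hw
      (((hf₁.ra 5 rfl).trans (hf.ra 5 rfl)).trans hK)
      (((hf₁.wa 0 rfl).trans (hf.wa 0 rfl)).trans hA) h₁.1 h₁.2.1 hW hAW hAs
  · intro o s' hf h hb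
    have ho : o = m := by
      have := h.pos_eq
      have := h.le
      simp only [BExp.Holds, WExp.eval, hf.w 10 rfl, hm] at hb
      omega
    subst ho
    refine ⟨h.out, ?_⟩
    -- The old counts are summed over `A` and the new ones over the output; both arrays are
    -- permutations of `A₀`, so the sums can be merged termwise.
    rw [h.count, hAs.sum_eq hw, ← h.out.sum_eq (by omega) (blockCount K pos A₀ n o w),
      ← Finset.sum_add_distrib]
    exact Finset.sum_congr rfl fun y _ => (blockCount_two_mul hw _).symm
  · refine ⟨h12, by omega, ⟨?_, ?_, ?_, ?_⟩, by simpa using h18, fun _ => .inl ⟨0, by simp⟩,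
      fun h => by omega⟩ <;> intros <;> omega

theorem run_copyLoop {s : State} (hm : s.w 10 = m) (h12 : s.w 12 = 0) (hW : m < W)
    (hB : ∀ x < m, s.wa 1 x < W) :
    Run W copyLoop s (m * 20 + 10) fun s' => ∀ x < m, s'.wa 0 x = s.wa 1 x := by
  refine (Run.loop m 10 (fun o s' => s'.w 12 = o ∧ o ≤ m ∧ ∀ x < o, s'.wa 0 x = s.wa 1 x)
    ?_ ?_ ?_).mono (by simp only [BExp.cost, WExp.cost]; omega) fun _ _ h => h
  · rintro o s' hf ⟨ho, _, h⟩ hb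
    simp only [BExp.Holds, WExp.eval, hf.w 10 rfl, hm] at hb
    refine ⟨by omega, Run.of_wp ?_ (by decide)⟩
    have e := hf.wa 1 rfl
    refine ⟨?_, ?_, ?_, ?_, ?_, ?_⟩ <;> simp [ho, e]
    · omega
    · exact hB _ (by omega)
    · omega
    · omega
    · intro x hx
      split_ifs with hxo
      · rw [hxo]
      · exact h x (by omega)
  · rintro o s' hf ⟨ho, _, h⟩ hb
    simp only [BExp.Holds, WExp.eval, hf.w 10 rfl, hm] at hb
    exact fun x hx => h x (by omega)
  · exact ⟨h12, by omega, fun x hx => by omega⟩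

theorem BlockSorted.congr {o : ℕ} {B : ℕ → ℕ} (h : BlockSorted K pos A₀ m o w A)
    (hB : ∀ x < o, B x = A x) : BlockSorted K pos A₀ m o w B where
  mem x hx := hB x hx ▸ h.mem x hx
  img x hx := hB x hx ▸ h.img x hx
  block x hx := hB x hx ▸ h.block x hx
  sorted x y c h₁ h₂ h₃ h₄ := by
    rw [hB x (h₂.trans h₄), hB y h₄]
    exact h.sorted x y c h₁ h₂ h₃ h₄

/-- The invariant of the sorting loop for blocks of width `w`. -/
structure SortInv (K : ℕ → ℝ) (pos A₀ : ℕ → ℕ) (n m w : ℕ) (s : State) : Prop where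
  width : s.w 11 = w
  sorted : BlockSorted K pos A₀ m m w (s.wa 0)
  count : s.w 18 = ∑ y ∈ Finset.range m, blockCount K pos A₀ n m w (s.wa 0 y)

theorem run_pass {s : State} (hm : s.w 10 = m) (hn : s.w 0 = n) (hw : 0 < w) (hwm : w < m)
    (hK : s.ra 5 = K) (hW : 2 * m * m + 2 * m + 1 < W) (hAW : ∀ x < m, A₀ x < W)
    (h : SortInv K pos A₀ n m w s) :
    Run W passProg s (m * 150 + 40) (SortInv K pos A₀ n m (2 * w)) := by
  have hent : ∀ {v : ℕ} {B : ℕ → ℕ}, BlockSorted K pos A₀ m m v B → ∀ x < m, B x < W :=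
    fun hB x hx => hB.img x hx ▸ hAW _ (hB.mem x hx)
  have init : Run W (.setW 12 (.lit 0) ;; .setW 16 (.lit 0)) s 5 fun s' =>
      s'.w 12 = 0 ∧ s'.w 16 = 0 := by
    refine Run.of_wp ?_ (by decide)
    refine ⟨?_, ?_, ?_⟩ <;> simp
    all_goals omega
  refine (init.seq fun s₁ f₁ h₁ => (run_mergeLoop ((f₁.w 10 rfl).trans hm)
    ((f₁.w 0 rfl).trans hn) hw ((f₁.w 11 rfl).trans h.width) ((f₁.ra 5 rfl).trans hK)
    (f₁.wa 0 rfl) (W := W) (by omega) (hent h.sorted) h.sorted h₁.1 h₁.2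
    ((f₁.w 18 rfl).trans h.count)).seq fun s₂ f₂ h₂ =>
    (Run.of_wp (T := 5) (Q := fun s' => s'.w 12 = 0 ∧ s'.wa = s₂.wa) ?_ (by decide)).seq
    fun s₃ f₃ h₃ => (run_copyLoop (m := m) (((f₃.w 10 rfl).trans
      ((f₂.w 10 rfl).trans (f₁.w 10 rfl))).trans hm) h₃.1
      (by omega) ?_).seq
    fun s₄ f₄ h₄ => Run.of_wp (T := 10) ?_ (by decide)).mono (by omega) fun _ _ h => h
  · refine ⟨?_, ?_, ?_⟩ <;> simp
    omega
  · rw [h₃.2]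
    exact hent h₂.1
  · have hwd : s₄.w 11 = w := by
      rw [f₄.w 11 rfl, f₃.w 11 rfl, f₂.w 11 rfl, f₁.w 11 rfl, h.width]
    rw [h₃.2] at h₄
    refine ⟨?_, ?_⟩
    · simp only [WExp.eval, hwd]
      omega
    · refine ⟨?_, ?_, ?_⟩ <;> simp
      · omega
      · exact h₂.1.congr h₄
      · rw [f₄.w 18 rfl, f₃.w 18 rfl, h₂.2]
        exact Finset.sum_congr rfl fun y hy => by rw [h₄ y (Finset.mem_range.1 hy)]

-- After `i` passes the blocks have width `2 ^ i`, so `L` passes suffice. Here `pos` may be any left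
-- inverse of the initial array: the identity in the first sort of a count, the inverse of the first
-- sorted order in the second.
open Classical in
theorem run_prog {s : State} {L : ℕ} (hm : s.w 10 = m) (hn : s.w 0 = n) (hL : m ≤ 2 ^ L)
    (hK : s.ra 5 = K) (hW : 2 * m * m + 2 * m + 1 < W) (hAW : ∀ x < m, s.wa 0 x < W)
    (hpos : ∀ x < m, pos (s.wa 0 x) = x) :
    Run W prog s (L * (m * 150 + 50) + 20) fun s' => Sorted K pos (s.wa 0) m (s'.wa 0) ∧
      s'.w 18 = ∑ y ∈ Finset.range m, ∑ x ∈ Finset.range m,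
        if Good K n (s.wa 0 x) (s.wa 0 y) ∧ x < y then 1 else 0 := by
  have init : Run W (.setW 18 (.lit 0) ;; .setW 11 (.lit 1)) s 10
      (SortInv K pos (s.wa 0) n m 1) := by
    refine Run.of_wp ?_ (by decide)
    refine ⟨?_, ?_, ?_, ?_, ?_⟩ <;> simp
    · omega
    · omega
    · exact blockSorted_one hpos
    · simp [blockCount_one]
  refine (init.seq fun s₁ f₁ h₁ => Run.loop (s := s₁) L (m * 150 + 40)
    (fun i s' => SortInv K pos (s.wa 0) n m (2 ^ i) s') ?_ ?_ (by simpa using h₁)).mono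
    (by simp only [BExp.cost, WExp.cost]; ring_nf; omega) fun _ _ h => h
  · intro i s' hf h hb
    have e := hf.w 10 rfl
    simp only [BExp.Holds, WExp.eval, e, f₁.w 10 rfl, hm, h.width, not_le] at hb
    refine ⟨(Nat.pow_lt_pow_iff_right (by norm_num)).1 (hb.trans_le hL), ?_⟩
    rw [pow_succ']
    exact run_pass ((e.trans (f₁.w 10 rfl)).trans hm)
      (((hf.w 0 rfl).trans (f₁.w 0 rfl)).trans hn) (by positivity) hb
      (((hf.ra 5 rfl).trans (f₁.ra 5 rfl)).trans hK) hW hAW h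
  · intro i s' hf h hb
    simp only [BExp.Holds, WExp.eval, hf.w 10 rfl, f₁.w 10 rfl, hm, h.width, not_not] at hb
    refine ⟨h.sorted.toSorted hb, ?_⟩
    rw [h.count, (h.sorted.toSorted hb).sum_eq]
    refine Finset.sum_congr rfl fun y hy => ?_
    have hy' := Finset.mem_range.1 hy
    rw [blockCount_of_le hb (by rwa [hpos y hy'])]
    exact Finset.sum_congr rfl fun x hx => by rw [hpos y hy', hpos x (Finset.mem_range.1 hx)]

end MergeSort
end RealRAM

namespace RealRAM

/-! ## Counting the pairs that satisfy two linear constraints -/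

namespace PairCount

open MergeSort

/-- The pair number `(x, y)` satisfies the constraint whose coefficients start at address `3 * i`
of real array `4`. -/
def Holds (s : State) (i x y : ℕ) : Prop :=
  s.ra 4 (3 * i + 2) ≤
    s.ra 4 (3 * i) * (s.ra 0 x + s.ra 2 y) + s.ra 4 (3 * i + 1) * (s.ra 1 x + s.ra 3 y)

open Classical in
/-- The number of pairs of indices below `n` with property `p`. -/
noncomputable def count (n : ℕ) (p : ℕ → ℕ → Prop) : ℕ :=
  ((Finset.range n ×ˢ Finset.range n).filter fun z => p z.1 z.2).card

open Classical in
theorem count_eq_sum (n : ℕ) (p : ℕ → ℕ → Prop) :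
    count n p = ∑ x ∈ Finset.range n, ∑ y ∈ Finset.range n, if p x y then 1 else 0 := by
  rw [count, Finset.card_filter, Finset.sum_product]

/-- A constraint on `p + q` separates into a term in `q` and a term in `p`. The `2 * n` keys label
items: `y < n` stands for a point of `Q`, `n + x` for a point of `P`, so feasibility is an order
relation between a small and a large item. -/
def keyQ (s : State) (i y : ℕ) : ℝ :=
  -(s.ra 4 (3 * i) * s.ra 2 y + s.ra 4 (3 * i + 1) * s.ra 3 y)

def keyP (s : State) (i x : ℕ) : ℝ :=
  s.ra 4 (3 * i) * s.ra 0 x + s.ra 4 (3 * i + 1) * s.ra 1 x - s.ra 4 (3 * i + 2)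

theorem keyQ_le_keyP {s : State} {i x y : ℕ} : keyQ s i y ≤ keyP s i x ↔ Holds s i x y := by
  unfold keyQ keyP Holds
  constructor <;> intro h <;> linarith

def fillProg (i : ℕ) : Program :=
  .setW 20 (.lit 0) ;; .loop (.not (.wle (.var 0) (.var 20)))
    (.putR 5 (.var 20) (.sub (.ofWord (.lit 0))
        (.add (.mul (.get 4 (.lit (3 * i))) (.get 2 (.var 20)))
          (.mul (.get 4 (.lit (3 * i + 1))) (.get 3 (.var 20))))) ;;
      .putR 5 (.add (.var 0) (.var 20))
        (.sub (.add (.mul (.get 4 (.lit (3 * i))) (.get 0 (.var 20)))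
          (.mul (.get 4 (.lit (3 * i + 1))) (.get 1 (.var 20)))) (.get 4 (.lit (3 * i + 2)))) ;;
      .setW 20 (.add (.var 20) (.lit 1)))

variable {W n m : ℕ} {s : State}

theorem run_fill (i : ℕ) (hn : s.w 0 = n) (hW : 2 * n < W) :
    Run W (fillProg i) s (n * 70 + 20) fun s' =>
      ∀ x < n, s'.ra 5 x = keyQ s i x ∧ s'.ra 5 (n + x) = keyP s i x := by
  have init : Run W (.setW 20 (.lit 0)) s 2 fun s' => s'.w 20 = 0 := by
    refine Run.of_wp ⟨?_, ?_⟩ (by decide) <;> simp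
    omega
  refine (init.seq fun s₁ f₁ h₁ => Run.loop (s := s₁) n 60 (fun o s' => s'.w 20 = o ∧ o ≤ n ∧
    ∀ x < o, s'.ra 5 x = keyQ s i x ∧ s'.ra 5 (n + x) = keyP s i x) ?_ ?_
    ⟨h₁, by omega, fun x hx => by omega⟩).mono
    (by simp only [BExp.cost, WExp.cost]; omega) fun _ _ h => h
  · rintro o s' hf ⟨ho, _, h⟩ hb
    have e0 : s'.w 0 = n := ((hf.w 0 rfl).trans (f₁.w 0 rfl)).trans hn
    have e (a : ℕ) (ha : Program.modRA a (fillProg i) = false) : s'.ra a = s.ra a :=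
      (hf.ra a ha).trans (f₁.ra a rfl)
    simp only [BExp.Holds, WExp.eval, e0] at hb
    refine ⟨by omega, Run.of_wp ?_ (Nat.le_of_ble_eq_true rfl)⟩
    refine ⟨?_, ?_, ?_, ?_⟩ <;>
      simp [ho, e0, e 0 rfl, e 1 rfl, e 2 rfl, e 3 rfl, e 4 rfl]
    · omega
    · omega
    · omega
    · refine ⟨by omega, fun x hx => ⟨?_, ?_⟩⟩
      · rw [if_neg (by omega)]
        split_ifs with hxo
        · rw [hxo, keyQ]; ring
        · exact (h x (by omega)).1
      · split_ifs with hxo hxo'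
        · rw [hxo, keyP]
        · omega
        · exact (h x (by omega)).2
  · rintro o s' hf ⟨ho, _, h⟩ hb
    simp only [BExp.Holds, WExp.eval, hf.w 0 rfl, f₁.w 0 rfl, hn] at hb
    exact fun x hx => h x (by omega)

def idProg : Program :=
  .setW 20 (.lit 0) ;; .loop (.not (.wle (.var 10) (.var 20)))
    (.putW 0 (.var 20) (.var 20) ;; .setW 20 (.add (.var 20) (.lit 1)))

theorem run_id (hm : s.w 10 = m) (hW : m < W) :
    Run W idProg s (m * 20 + 20) fun s' => ∀ x < m, s'.wa 0 x = x := by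
  have init : Run W (.setW 20 (.lit 0)) s 2 fun s' => s'.w 20 = 0 := by
    refine Run.of_wp ⟨?_, ?_⟩ (by decide) <;> simp
    omega
  refine (init.seq fun s₁ f₁ h₁ => Run.loop (s := s₁) m 10 (fun o s' => s'.w 20 = o ∧ o ≤ m ∧
    ∀ x < o, s'.wa 0 x = x) ?_ ?_ ⟨h₁, by omega, fun x hx => by omega⟩).mono
    (by simp only [BExp.cost, WExp.cost]; omega) fun _ _ h => h
  · rintro o s' hf ⟨ho, _, h⟩ hb
    simp only [BExp.Holds, WExp.eval, hf.w 10 rfl, f₁.w 10 rfl, hm] at hb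
    refine ⟨by omega, Run.of_wp ?_ (by decide)⟩
    refine ⟨?_, ?_, ?_, ?_, ?_, ?_⟩ <;> simp [ho]
    · omega
    · omega
    · omega
    · omega
    · intro x hx
      split_ifs with hxo
      · exact hxo.symm
      · exact h x (by omega)
  · rintro o s' hf ⟨ho, _, h⟩ hb
    simp only [BExp.Holds, WExp.eval, hf.w 10 rfl, f₁.w 10 rfl, hm] at hb
    exact fun x hx => h x (by omega)

end PairCount

namespace MergeSort

/-! ### Two successive sorts count dominating pairs. -/

variable {K : ℕ → ℝ} {pos A₀ A : ℕ → ℕ} {m : ℕ}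

theorem Sorted.exists_inverse (h : Sorted K pos A₀ m A) :
    ∃ pos' : ℕ → ℕ, ∀ x < m, pos' (A x) = x := by
  have hinj : Set.InjOn A (Set.Iio m) := by
    intro x hx y hy he
    rcases lt_trichotomy x y with hl | hl | hl
    · exact absurd he (h.sorted x y hl hy).ne
    · exact hl
    · exact absurd he.symm (h.sorted y x hl hx).ne
  exact ⟨Function.invFunOn A (Set.Iio m), fun x hx => hinj.leftInvOn_invFunOn hx⟩

/-- Sorting by two keys and counting in the second sort counts dominating pairs. -/
theorem Sorted.sum_good {K₁ K₂ : ℕ → ℝ} {n : ℕ} (h : Sorted K₁ id id m A) :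
    open Classical in
    (∑ y ∈ Finset.range m, ∑ x ∈ Finset.range m,
      if Good K₂ n (A x) (A y) ∧ x < y then 1 else 0) =
    ∑ b ∈ Finset.range m, ∑ a ∈ Finset.range m,
      if Good K₂ n a b ∧ K₁ a ≤ K₁ b then 1 else 0 := by
  classical
  have e := h.sum_eq fun b => ∑ a ∈ Finset.range m, if Good K₂ n a b ∧ K₁ a ≤ K₁ b then 1 else 0
  simp only [id] at e
  rw [← e]
  refine Finset.sum_congr rfl fun y hy => ?_
  have e' := h.sum_eq fun a => if Good K₂ n a (A y) ∧ K₁ a ≤ K₁ (A y) then 1 else 0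
  simp only [id] at e'
  rw [← e']
  refine Finset.sum_congr rfl fun x hx => if_congr (and_congr_right fun hg => ?_) rfl rfl
  have hx' := Finset.mem_range.1 hx
  have hy' := Finset.mem_range.1 hy
  have := hg.1
  have := hg.2.1
  constructor
  · intro hlt
    rcases h.sorted x y hlt hy' with hk | hk
    · exact hk.le
    · exact hk.1.le
  -- Ties of `K₁` are broken by the item number, as the first sort started from the identity; since
  -- `A x < n ≤ A y`, a tie also puts `A x` first.
  · intro hle
    by_contra hlt
    rcases (show x = y ∨ y < x by omega) with rfl | hlt
    · omega
    · rcases h.sorted y x hlt hx' with hk | hk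
      · exact absurd hle (not_le.2 hk)
      · have := hk.2
        simp only [id] at this
        omega

end MergeSort

namespace PairCount

open MergeSort

variable {W n m : ℕ} {s : State}

/-- A good pair has its first item below `n` and its second at least `n`, so of the four quadrants
of the double sum only the one indexed by `Q × P` survives. -/
theorem sum_good_eq_count {K₁ K₂ : ℕ → ℝ} {i j : ℕ}
    (h₁ : ∀ x < n, K₁ x = keyQ s i x ∧ K₁ (n + x) = keyP s i x)
    (h₂ : ∀ x < n, K₂ x = keyQ s j x ∧ K₂ (n + x) = keyP s j x) :
    open Classical in
    (∑ b ∈ Finset.range (n + n), ∑ a ∈ Finset.range (n + n),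
      if Good K₂ n a b ∧ K₁ a ≤ K₁ b then 1 else 0) =
    count n fun x y => Holds s i x y ∧ Holds s j x y := by
  classical
  rw [count_eq_sum, Finset.sum_range_add, Finset.sum_eq_zero, zero_add]
  · refine Finset.sum_congr rfl fun x hx => ?_
    have hx' := Finset.mem_range.1 hx
    rw [Finset.sum_range_add]
    conv_rhs => rw [← add_zero (Finset.sum _ _)]
    congr 1
    · refine Finset.sum_congr rfl fun y hy => ?_
      have hy' := Finset.mem_range.1 hy
      have key : Good K₂ n y (n + x) ∧ K₁ y ≤ K₁ (n + x) ↔ Holds s i x y ∧ Holds s j x y := by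
        simp only [Good, (h₁ x hx').2, (h₂ x hx').2, (h₁ y hy').1, (h₂ y hy').1, keyQ_le_keyP]
        constructor
        · rintro ⟨⟨_, _, h⟩, h'⟩
          exact ⟨h', h⟩
        · rintro ⟨h', h⟩
          exact ⟨⟨hy', by omega, h⟩, h'⟩
      by_cases h : Holds s i x y ∧ Holds s j x y
      · rw [if_pos h, if_pos (key.2 h)]
      · rw [if_neg h, if_neg (mt key.1 h)]
    · refine Finset.sum_eq_zero fun y hy => if_neg ?_
      rintro ⟨⟨h, _⟩, _⟩
      omega
  · intro b hb
    have hb' := Finset.mem_range.1 hb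
    refine Finset.sum_eq_zero fun a ha => if_neg ?_
    rintro ⟨⟨_, h, _⟩, _⟩
    omega

/-- Counts in `w 18` the pairs that satisfy the constraints `i` and `j`. -/
def prog (i j : ℕ) : Program :=
  .setW 10 (.add (.var 0) (.var 0)) ;; idProg ;; fillProg i ;; MergeSort.prog ;; fillProg j ;;
    MergeSort.prog

theorem Holds.congr {s' : State} (h0 : s'.ra 0 = s.ra 0) (h1 : s'.ra 1 = s.ra 1)
    (h2 : s'.ra 2 = s.ra 2) (h3 : s'.ra 3 = s.ra 3) (h4 : s'.ra 4 = s.ra 4) :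
    Holds s' = Holds s := by
  unfold Holds
  rw [h0, h1, h2, h3, h4]

theorem run_prog {L : ℕ} (i j : ℕ) (hn : s.w 0 = n) (hL : n + n ≤ 2 ^ L)
    (hW : 8 * n * n + 4 * n + 1 < W) :
    Run W (prog i j) s (L * (n * 600 + 100) + n * 200 + 200) fun s' =>
      s'.w 18 = count n fun x y => Holds s i x y ∧ Holds s j x y := by
  have hW' : 2 * (n + n) * (n + n) + 2 * (n + n) + 1 < W := by
    calc _ = 8 * n * n + 4 * n + 1 := by ring
      _ < W := hW
  have hn' : n + n < W := by omega
  have init : Run W (.setW 10 (.add (.var 0) (.var 0))) s 5 fun s' => s'.w 10 = n + n := by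
    refine Run.of_wp ⟨?_, ?_⟩ (by decide) <;> simp [hn, hn']
  rw [prog]
  refine Run.mono (T₁ := 5 + ((n + n) * 20 + 20 + (n * 70 + 20 + (L * ((n + n) * 150 + 50) + 20 +
    (n * 70 + 20 + (L * ((n + n) * 150 + 50) + 20)))))) (init.seq fun s₁ f₁ h₁ =>
    (run_id h₁ hn').seq fun s₂ f₂ h₂ =>
    (run_fill i (((f₂.w 0 rfl).trans (f₁.w 0 rfl)).trans hn) (by omega)).seq fun s₃ f₃ h₃ =>
    (MergeSort.run_prog (pos := id) (n := n) (L := L) (s := s₃)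
      (((f₃.w 10 rfl).trans (f₂.w 10 rfl)).trans h₁)
      ((((f₃.w 0 rfl).trans (f₂.w 0 rfl)).trans (f₁.w 0 rfl)).trans hn) hL rfl hW'
      (fun x hx => by rw [f₃.wa 0 rfl, h₂ x hx]; omega)
      (fun x hx => by rw [f₃.wa 0 rfl, h₂ x hx]; rfl)).seq fun s₄ f₄ h₄ =>
    (run_fill j ((((f₄.w 0 rfl).trans (f₃.w 0 rfl)).trans ((f₂.w 0 rfl).trans
      (f₁.w 0 rfl))).trans hn) (by omega)).seq fun s₅ f₅ h₅ => ?_) ?_ fun _ _ h => h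
  · obtain ⟨h₄, -⟩ := h₄
    have hsort : Sorted (s₃.ra 5) id id (n + n) (s₅.wa 0) := by
      rw [f₅.wa 0 rfl]
      refine ⟨h₄.mem, fun x hx => ?_, h₄.sorted⟩
      have := h₄.img x hx
      rwa [f₃.wa 0 rfl, h₂ _ (h₄.mem x hx)] at this
    -- The second sort starts from the output of the first, so original positions now mean ranks in
    -- the `i`-th order.
    obtain ⟨pos, hpos⟩ := hsort.exists_inverse
    refine (MergeSort.run_prog (pos := pos) (n := n) (L := L) (s := s₅) ?_ ?_ hL rfl hW'
      (fun x hx => ?_) hpos).mono le_rfl fun s₆ f₆ h₆ => ?_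
    · rw [f₅.w 10 rfl, f₄.w 10 rfl, f₃.w 10 rfl, f₂.w 10 rfl, h₁]
    · rw [f₅.w 0 rfl, f₄.w 0 rfl, f₃.w 0 rfl, f₂.w 0 rfl, f₁.w 0 rfl, hn]
    · rw [← hsort.img x hx]
      have := hsort.mem x hx
      simp only [id] at this ⊢
      omega
    · rw [h₆.2, hsort.sum_good]
      refine sum_good_eq_count (fun x hx => ?_) fun x hx => ?_
      · have := h₃ x hx
        simp only [keyQ, keyP] at this ⊢
        rw [f₂.ra 0 rfl, f₂.ra 1 rfl, f₂.ra 2 rfl, f₂.ra 3 rfl, f₂.ra 4 rfl, f₁.ra 0 rfl,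
          f₁.ra 1 rfl, f₁.ra 2 rfl, f₁.ra 3 rfl, f₁.ra 4 rfl] at this
        exact this
      · have := h₅ x hx
        simp only [keyQ, keyP] at this ⊢
        rw [f₄.ra 0 rfl, f₄.ra 1 rfl, f₄.ra 2 rfl, f₄.ra 3 rfl, f₄.ra 4 rfl, f₃.ra 0 rfl,
          f₃.ra 1 rfl, f₃.ra 2 rfl, f₃.ra 3 rfl, f₃.ra 4 rfl, f₂.ra 0 rfl, f₂.ra 1 rfl,
          f₂.ra 2 rfl, f₂.ra 3 rfl, f₂.ra 4 rfl, f₁.ra 0 rfl, f₁.ra 1 rfl, f₁.ra 2 rfl,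
          f₁.ra 3 rfl, f₁.ra 4 rfl] at this
        exact this
  · ring_nf
    omega

end PairCount
end RealRAM

namespace RealRAM

namespace PairCount

/-! ## Counting the pairs that satisfy three linearly dependent constraints -/

variable {W n : ℕ} {s : State}

theorem count_congr {p q : ℕ → ℕ → Prop} (h : ∀ x y, p x y ↔ q x y) : count n p = count n q := by
  obtain rfl : p = q := by
    funext x y
    exact propext (h x y)
  rfl

theorem count_split (p q : ℕ → ℕ → Prop) :
    count n p = count n (fun x y => p x y ∧ q x y) + count n fun x y => p x y ∧ ¬ q x y := by
  classical
  simp only [count_eq_sum, ← Finset.sum_add_distrib]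
  refine Finset.sum_congr rfl fun x _ => Finset.sum_congr rfl fun y _ => ?_
  by_cases hp : p x y <;> by_cases hq : q x y <;> simp [hp, hq]

theorem count_true : count n (fun _ _ => True) = n * n := by
  simp [count_eq_sum]

theorem count_false {p : ℕ → ℕ → Prop} (h : ∀ x y, ¬ p x y) : count n p = 0 := by
  simp [count_eq_sum, h]

theorem count_le (p : ℕ → ℕ → Prop) : count n p ≤ n * n := by
  rw [← count_true, count_split (fun _ _ => True) p]
  simp

/-- The number of pairs for which the truth values of `A`, `B`, `C` are `a`, `b`, `c`. -/
noncomputable def cell (n : ℕ) (A B C : ℕ → ℕ → Prop) (a b c : Prop) : ℕ :=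
  count n fun x y => (A x y ↔ a) ∧ (B x y ↔ b) ∧ (C x y ↔ c)

open Classical in
/-- A Boolean combination of `A`, `B` and `C` holds for the pairs in a union of cells. -/
theorem count_eq_cells (A B C : ℕ → ℕ → Prop) (f : Prop → Prop → Prop → Prop) :
    count n (fun x y => f (A x y) (B x y) (C x y)) =
      (if f True True True then cell n A B C True True True else 0) +
      (if f True True False then cell n A B C True True False else 0) +
      (if f True False True then cell n A B C True False True else 0) +
      (if f True False False then cell n A B C True False False else 0) +
      (if f False True True then cell n A B C False True True else 0) +
      (if f False True False then cell n A B C False True False else 0) +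
      (if f False False True then cell n A B C False False True else 0) +
      (if f False False False then cell n A B C False False False else 0) := by
  have hif (p : Prop) (q : ℕ → ℕ → Prop) : (if p then count n q else 0) =
      ∑ x ∈ Finset.range n, ∑ y ∈ Finset.range n, if p ∧ q x y then 1 else 0 := by
    by_cases hp : p <;> simp [hp, count_eq_sum]
  simp only [cell, hif]
  simp only [count_eq_sum, ← Finset.sum_add_distrib]
  refine Finset.sum_congr rfl fun x _ => Finset.sum_congr rfl fun y _ => ?_
  by_cases hA : A x y <;> by_cases hB : B x y <;> by_cases hC : C x y <;> simp [hA, hB, hC]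

/-- The combination of the counts for one and two constraints that gives the count for all three:
each of the eight cells yields a lower or an upper bound, which is attained if the cell is empty. -/
def combine (N a b c ab ac bc e : ℕ) : ℕ :=
  if e % 2 = 0 then max (max (ab + ac - a) (ab + bc - b)) (ac + bc - c)
  else min (min (min ab ac) bc) (N + ab + ac + bc - (a + b + c))

/-- The cells are listed as TTT, TTF, TFT, TFF, FTT, FTF, FFT, FFF. Those with an even number of
failures are `x₁, x₄, x₆, x₇`: if one of the last three is empty, the maximum is `x₁`, and if `x₁`
is empty, truncation makes it `0`. Those with an odd number are `x₂, x₃, x₅, x₈`: if one is empty,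
the minimum vanishes. Hence only the parity `e` of the empty cell must be known. -/
theorem combine_cells (x₁ x₂ x₃ x₄ x₅ x₆ x₇ x₈ e : ℕ) :
    combine (x₁ + x₂ + x₃ + x₄ + x₅ + x₆ + x₇ + x₈) (x₁ + x₂ + x₃ + x₄) (x₁ + x₂ + x₅ + x₆)
      (x₁ + x₃ + x₅ + x₇) (x₁ + x₂) (x₁ + x₃) (x₁ + x₅) e =
    if e % 2 = 0 then max (max (x₁ - x₄) (x₁ - x₆)) (x₁ - x₇)
      else x₁ + min (min (min x₂ x₃) x₅) x₈ := by
  have e₁ : x₁ + x₂ + (x₁ + x₃) - (x₁ + x₂ + x₃ + x₄) = x₁ - x₄ := by omega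
  have e₂ : x₁ + x₂ + (x₁ + x₅) - (x₁ + x₂ + x₅ + x₆) = x₁ - x₆ := by omega
  have e₃ : x₁ + x₃ + (x₁ + x₅) - (x₁ + x₃ + x₅ + x₇) = x₁ - x₇ := by omega
  have e₄ : x₁ + x₂ + x₃ + x₄ + x₅ + x₆ + x₇ + x₈ + (x₁ + x₂) + (x₁ + x₃) + (x₁ + x₅) -
      (x₁ + x₂ + x₃ + x₄ + (x₁ + x₂ + x₅ + x₆) + (x₁ + x₃ + x₅ + x₇)) = x₁ + x₈ := by omega
  rw [combine, e₁, e₂, e₃, e₄, ← Nat.add_min_add_left, ← Nat.add_min_add_left,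
    ← Nat.add_min_add_left]

theorem combine_eq (A B C : ℕ → ℕ → Prop) {a b c : Prop} [Decidable a] [Decidable b] [Decidable c]
    (h : cell n A B C a b c = 0) {e : ℕ} (he : e % 2 =
      ((if a then 0 else 1) + (if b then 0 else 1) + (if c then 0 else 1)) % 2) :
    combine (n * n) (count n A) (count n B) (count n C) (count n fun x y => A x y ∧ B x y)
      (count n fun x y => A x y ∧ C x y) (count n fun x y => B x y ∧ C x y) e =
    count n fun x y => A x y ∧ B x y ∧ C x y := by
  have h₀ := count_eq_cells (n := n) A B C fun _ _ _ => True
  have h₁ := count_eq_cells (n := n) A B C fun a _ _ => a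
  have h₂ := count_eq_cells (n := n) A B C fun _ b _ => b
  have h₃ := count_eq_cells (n := n) A B C fun _ _ c => c
  have h₄ := count_eq_cells (n := n) A B C fun a b _ => a ∧ b
  have h₅ := count_eq_cells (n := n) A B C fun a _ c => a ∧ c
  have h₆ := count_eq_cells (n := n) A B C fun _ b c => b ∧ c
  have h₇ := count_eq_cells (n := n) A B C fun a b c => a ∧ b ∧ c
  simp only [and_true, and_false, and_self, if_true, if_false, count_true] at h₀ h₁ h₂ h₃ h₄ h₅ h₆ h₇
  simp only [add_zero] at h₀ h₁ h₂ h₃ h₄ h₅ h₆ h₇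
  rw [h₀, h₁, h₂, h₃, h₄, h₅, h₆, h₇, combine_cells, he]
  by_cases ha : a <;> by_cases hb : b <;> by_cases hc : c <;>
    simp only [ha, hb, hc] at h <;> simp [ha, hb, hc, h]

theorem mul_nonneg_of_iff {a z : ℝ} (h : 0 ≤ z ↔ 0 ≤ a) : 0 ≤ a * z := by
  rcases le_or_gt 0 a with ha | ha
  · exact mul_nonneg ha (h.2 ha)
  · exact mul_nonneg_of_nonpos_of_nonpos ha.le (le_of_lt (not_le.1 (mt h.1 (not_le.2 ha))))

theorem mul_nonpos_of_iff {a z : ℝ} (h : 0 ≤ z ↔ ¬ 0 ≤ a) : a * z ≤ 0 ∧ (0 < a → a * z < 0) := by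
  rcases lt_trichotomy 0 a with ha | rfl | ha
  · have hz : z < 0 := not_le.1 fun hz => h.1 hz ha.le
    exact ⟨(mul_neg_of_pos_of_neg ha hz).le, fun _ => mul_neg_of_pos_of_neg ha hz⟩
  · simp
  · exact ⟨mul_nonpos_of_nonpos_of_nonneg ha.le (h.2 (not_le.2 ha)), fun h' => absurd ha h'.not_gt⟩

-- If `δ < 0`, the slacks cannot have the sign pattern of `α, β, γ`, since the combination would be
-- nonnegative. If `0 ≤ δ`, they cannot have the opposite pattern: every term would be `≤ 0`, and a
-- positive coefficient makes one of them negative. So one cell is empty in either case.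
open Classical in
theorem combine_eq_of_dependent (z₁ z₂ z₃ : ℕ → ℕ → ℝ) {α β γ δ : ℝ}
    (hdep : ∀ x y, α * z₁ x y + β * z₂ x y + γ * z₃ x y = δ) (hpos : 0 < α ∨ 0 < β ∨ 0 < γ)
    {e : ℕ} (he : e = (if α < 0 then 1 else 0) + (if β < 0 then 1 else 0) +
      (if γ < 0 then 1 else 0) + if 0 ≤ δ then 1 else 0) :
    combine (n * n) (count n fun x y => 0 ≤ z₁ x y) (count n fun x y => 0 ≤ z₂ x y)
      (count n fun x y => 0 ≤ z₃ x y) (count n fun x y => 0 ≤ z₁ x y ∧ 0 ≤ z₂ x y)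
      (count n fun x y => 0 ≤ z₁ x y ∧ 0 ≤ z₃ x y) (count n fun x y => 0 ≤ z₂ x y ∧ 0 ≤ z₃ x y) e =
    count n fun x y => 0 ≤ z₁ x y ∧ 0 ≤ z₂ x y ∧ 0 ≤ z₃ x y := by
  have hif (r : ℝ) : (if r < 0 then 1 else 0) = if 0 ≤ r then 0 else 1 := by
    split_ifs <;> first | rfl | (exfalso; linarith)
  have hif' (r : ℝ) : (if 0 ≤ r then 0 else 1) + (if ¬ 0 ≤ r then 0 else 1) = 1 := by
    split_ifs <;> rfl
  by_cases hδ : 0 ≤ δ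
  · refine combine_eq _ _ _ (a := ¬ 0 ≤ α) (b := ¬ 0 ≤ β) (c := ¬ 0 ≤ γ)
      (count_false fun x y h => ?_) ?_
    · have h₁ := mul_nonpos_of_iff h.1
      have h₂ := mul_nonpos_of_iff h.2.1
      have h₃ := mul_nonpos_of_iff h.2.2
      have := hdep x y
      rcases hpos with hp | hp | hp
      · linarith [h₁.2 hp]
      · linarith [h₂.2 hp]
      · linarith [h₃.2 hp]
    -- The empty cell fails once per nonnegative coefficient, that is, three minus the number of
    -- negative ones; the extra `1` in `e` corrects the parity.
    · rw [he, hif, hif, hif, if_pos hδ]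
      have := hif' α
      have := hif' β
      have := hif' γ
      omega
  · refine combine_eq _ _ _ (a := 0 ≤ α) (b := 0 ≤ β) (c := 0 ≤ γ)
      (count_false fun x y h => ?_) ?_
    · have h₁ := mul_nonneg_of_iff h.1
      have h₂ := mul_nonneg_of_iff h.2.1
      have h₃ := mul_nonneg_of_iff h.2.2
      have := hdep x y
      linarith
    · rw [he, hif, hif, hif, if_neg hδ, add_zero]

end PairCount
end RealRAM

namespace RealRAM

namespace PairCount

variable {W n : ℕ} {s : State}

/-! ### The program for three constraints: dependency, parity, combination. -/

def coef (k : ℕ) : RExp := .get 4 (.lit k)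

def zero : RExp := .ofWord (.lit 0)

def isZero (e : RExp) : BExp := .and (.rle e zero) (.rle zero e)

theorem isZero_holds {e : RExp} : (isZero e).Holds s ↔ e.eval s = 0 := by
  simp [isZero, zero, le_antisymm_iff]

/-- `α`, `β`, `γ` is a linear dependency of the normals of the three constraints in real
array `4`. -/
def IsDependency (s : State) (α β γ : ℝ) : Prop :=
  α * s.ra 4 0 + β * s.ra 4 3 + γ * s.ra 4 6 = 0 ∧ α * s.ra 4 1 + β * s.ra 4 4 + γ * s.ra 4 7 = 0

/-- The dependency is the cross product of the two coordinate columns of the three normals. If it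
vanishes, the normals are parallel: then `(1, 0, 0)` works if the first normal is zero, and `(⟨n₁,
n₂⟩, -|n₁|², 0)` otherwise. -/
def crossProg : Program :=
  (.setR 2 (.sub (.mul (coef 3) (coef 7)) (.mul (coef 4) (coef 6))) ;;
    .setR 3 (.sub (.mul (coef 6) (coef 1)) (.mul (coef 7) (coef 0))) ;;
    .setR 4 (.sub (.mul (coef 0) (coef 4)) (.mul (coef 1) (coef 3)))) ;;
  .branch (.and (isZero (.var 2)) (.and (isZero (.var 3)) (isZero (.var 4))))
    (.branch (.and (isZero (coef 0)) (isZero (coef 1)))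
      (.setR 2 (.ofWord (.lit 1)))
      (.setR 2 (.add (.mul (coef 0) (coef 3)) (.mul (coef 1) (coef 4))) ;;
        .setR 3 (.sub zero (.add (.mul (coef 0) (coef 0)) (.mul (coef 1) (coef 1))))))
    .skip

theorem run_cross : Run W crossProg s 150 fun s' =>
    IsDependency s (s'.r 2) (s'.r 3) (s'.r 4) ∧ (s'.r 2 ≠ 0 ∨ s'.r 3 ≠ 0 ∨ s'.r 4 ≠ 0) := by
  refine Run.of_wp ?_ (by decide)
  simp only [crossProg, Program.wp, BExp.Holds, isZero_holds]
  simp only [RExp.eval, WExp.eval, State.setR_r, State.setR_ra, coef, zero, IsDependency]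
  simp only [Nat.reduceEqDiff, if_true, if_false, Nat.cast_zero,
    Nat.cast_one, zero_sub]
  generalize s.ra 4 0 = a₁, s.ra 4 1 = b₁, s.ra 4 3 = a₂, s.ra 4 4 = b₂, s.ra 4 6 = a₃,
    s.ra 4 7 = b₃
  refine ⟨fun ⟨h₁, h₂, h₃⟩ => ⟨fun ⟨h₄, h₅⟩ => ?_, fun h₄ => ?_⟩, fun h => ?_⟩
  · subst h₄ h₅
    simp
  · refine ⟨⟨?_, ?_⟩, ?_⟩
    · linear_combination (b₁ + a₃) * h₃
    · linear_combination (-a₁ + b₃) * h₃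
    · right; left
      intro h
      refine h₄ ⟨?_, ?_⟩ <;> nlinarith [sq_nonneg a₁, sq_nonneg b₁]
  · refine ⟨⟨by ring, by ring⟩, ?_⟩
    tauto

/-- Changes the sign of a dependency without positive coefficient, as `combine_eq_of_dependent`
requires one. -/
def normProg : Program :=
  .branch (.and (.rle (.var 2) zero) (.and (.rle (.var 3) zero) (.rle (.var 4) zero)))
    (.setR 2 (.sub zero (.var 2)) ;; .setR 3 (.sub zero (.var 3)) ;;
      .setR 4 (.sub zero (.var 4)))
    .skip

theorem run_norm (h : IsDependency s (s.r 2) (s.r 3) (s.r 4))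
    (h0 : s.r 2 ≠ 0 ∨ s.r 3 ≠ 0 ∨ s.r 4 ≠ 0) : Run W normProg s 50 fun s' =>
    IsDependency s (s'.r 2) (s'.r 3) (s'.r 4) ∧ (0 < s'.r 2 ∨ 0 < s'.r 3 ∨ 0 < s'.r 4) := by
  refine Run.of_wp ?_ (by decide)
  simp only [normProg, Program.wp, BExp.Holds]
  simp [zero]
  refine ⟨fun h₁ h₂ h₃ => ⟨?_, ?_⟩, fun h₁ => ⟨h, ?_⟩⟩
  · unfold IsDependency at h ⊢
    constructor <;> linarith [h.1, h.2]
  · rcases h0 with h0 | h0 | h0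
    · exact .inl (lt_of_le_of_ne h₁ h0)
    · exact .inr (.inl (lt_of_le_of_ne h₂ h0))
    · exact .inr (.inr (lt_of_le_of_ne h₃ h0))
  · by_contra hc
    push Not at hc
    exact absurd (h₁ hc.1 hc.2.1) (not_lt.2 hc.2.2)

def bump (b : BExp) : Program := .branch b (.setW 37 (.add (.var 37) (.lit 1))) .skip

def bitProg : Program :=
  .setR 5 (.sub zero (.add (.add (.mul (.var 2) (coef 2)) (.mul (.var 3) (coef 5)))
    (.mul (.var 4) (coef 8)))) ;;
  .setW 37 (.lit 0) ;; bump (.not (.rle zero (.var 2))) ;; bump (.not (.rle zero (.var 3))) ;;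
  bump (.not (.rle zero (.var 4))) ;; bump (.rle zero (.var 5))

-- The added bit `i` stays a variable in the continuation, so four bumps chain without splitting
-- into sixteen cases.
open Classical in
theorem bump_wp {b : BExp} {Q : State → Prop} {v : ℕ} (hv : s.w 37 = v) (hW : v + 1 < W)
    (h : ∀ i ≤ 1, i = (if b.Holds s then 1 else 0) → Q (s.setW 37 (v + i))) :
    (bump b).wp W Q s := by
  subst hv
  refine ⟨fun hb => ⟨hW, ?_⟩, fun hb => ?_⟩
  · exact h 1 le_rfl (by rw [if_pos hb])
  · have e : s.setW 37 (s.w 37) = s := by simp [State.setW]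
    simpa [e] using h 0 (by omega) (by rw [if_neg hb])

open Classical in
theorem run_bit (hW : 5 < W) : Run W bitProg s 100 fun s' =>
    s'.w 37 = (if s.r 2 < 0 then 1 else 0) + (if s.r 3 < 0 then 1 else 0) +
      (if s.r 4 < 0 then 1 else 0) +
      if 0 ≤ -(s.r 2 * s.ra 4 2 + s.r 3 * s.ra 4 5 + s.r 4 * s.ra 4 8) then 1 else 0 := by
  refine Run.of_wp ?_ (by decide)
  refine ⟨?_, ?_⟩
  · simp; omega
  · refine bump_wp (v := 0) (by simp) (by omega) fun i₁ b₁ h₁ =>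
      bump_wp (v := 0 + i₁) (by simp) (by omega) fun i₂ b₂ h₂ =>
      bump_wp (v := 0 + i₁ + i₂) (by simp) (by omega) fun i₃ b₃ h₃ =>
      bump_wp (v := 0 + i₁ + i₂ + i₃) (by simp) (by omega) fun i₄ b₄ h₄ => ?_
    simp only [BExp.Holds, RExp.eval, WExp.eval, zero, coef, not_le, State.setW_r, State.setR_r,
      Nat.cast_zero, Nat.reduceEqDiff, if_true, if_false,
      zero_sub] at h₁ h₂ h₃ h₄
    rw [State.setW_w, if_pos rfl, h₁, h₂, h₃, h₄, zero_add]

/-- Stores the value of `w 18` after running `prog i j`. -/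
def store (i j x : ℕ) : Program := prog i j ;; .setW x (.var 18)

/-- In truncated arithmetic `x + (y - x)` is the maximum and `x - (x - y)` the minimum. -/
def maxProg : Program :=
  .setW 36 (.sub (.add (.var 33) (.var 34)) (.var 30)) ;;
  .setW 38 (.sub (.add (.var 33) (.var 35)) (.var 31)) ;;
  .setW 36 (.add (.var 36) (.sub (.var 38) (.var 36))) ;;
  .setW 38 (.sub (.add (.var 34) (.var 35)) (.var 32)) ;;
  .setW 36 (.add (.var 36) (.sub (.var 38) (.var 36)))

def minProg : Program :=
  .setW 36 (.sub (.var 33) (.sub (.var 33) (.var 34))) ;;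
  .setW 36 (.sub (.var 36) (.sub (.var 36) (.var 35))) ;;
  .setW 38 (.sub (.add (.add (.add (.mul (.var 0) (.var 0)) (.var 33)) (.var 34)) (.var 35))
    (.add (.add (.var 30) (.var 31)) (.var 32))) ;;
  .setW 36 (.sub (.var 36) (.sub (.var 36) (.var 38)))

def combineProg : Program :=
  .branch (.wle (.var 37) (.mul (.lit 2) (.div (.var 37) (.lit 2)))) maxProg minProg

theorem run_combine (hn : s.w 0 = n) (hW : 4 * n * n < W) (h₁ : s.w 33 ≤ n * n)
    (h₂ : s.w 34 ≤ n * n) (h₃ : s.w 35 ≤ n * n) : Run W combineProg s 120 fun s' =>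
    s'.w 36 =
      combine (n * n) (s.w 30) (s.w 31) (s.w 32) (s.w 33) (s.w 34) (s.w 35) (s.w 37) := by
  rw [mul_assoc] at hW
  refine Run.of_wp ?_ (by decide)
  refine ⟨fun hb => ?_, fun hb => ?_⟩
  · have he : s.w 37 % 2 = 0 := by
      simp only [BExp.Holds, WExp.eval] at hb
      omega
    refine ⟨?_, ?_, ?_, ?_, ?_, ?_⟩ <;> simp [combine, he] <;> omega
  · have he : s.w 37 % 2 ≠ 0 := by
      simp only [BExp.Holds, WExp.eval] at hb
      omega
    refine ⟨?_, ?_, ?_, ?_, ?_⟩ <;> simp [combine, he, hn] <;> omega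

end PairCount
end RealRAM

namespace RealRAM

namespace PairCount

/-! ### Correctness of the triple count. -/

variable {W n L : ℕ} {s s₀ : State}

/-- The points, the constraints and their number are the same in both states. -/
structure SameInput (s₀ s : State) : Prop where
  w0 : s.w 0 = s₀.w 0
  ra0 : s.ra 0 = s₀.ra 0
  ra1 : s.ra 1 = s₀.ra 1
  ra2 : s.ra 2 = s₀.ra 2
  ra3 : s.ra 3 = s₀.ra 3
  ra4 : s.ra 4 = s₀.ra 4

theorem SameInput.holds (h : SameInput s₀ s) : Holds s = Holds s₀ :=
  Holds.congr h.ra0 h.ra1 h.ra2 h.ra3 h.ra4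

theorem SameInput.frame {p : Program} {s' : State} (h : SameInput s₀ s) (hf : Frame p s s')
    (h0 : p.modW 0 = false) (h1 : p.modRA 0 = false) (h2 : p.modRA 1 = false)
    (h3 : p.modRA 2 = false) (h4 : p.modRA 3 = false) (h5 : p.modRA 4 = false) :
    SameInput s₀ s' :=
  ⟨(hf.w 0 h0).trans h.w0, (hf.ra 0 h1).trans h.ra0, (hf.ra 1 h2).trans h.ra1,
    (hf.ra 2 h3).trans h.ra2, (hf.ra 3 h4).trans h.ra3, (hf.ra 4 h5).trans h.ra4⟩

theorem run_store (i j x : ℕ) (h : SameInput s₀ s) (hn : s₀.w 0 = n) (hL : n + n ≤ 2 ^ L)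
    (hW : 8 * n * n + 4 * n + 1 < W) :
    Run W (store i j x) s (L * (n * 600 + 100) + n * 200 + 210) fun s' =>
      s'.w x = count n fun x y => Holds s₀ i x y ∧ Holds s₀ j x y := by
  refine Run.mono (T₁ := _ + 10) ((run_prog i j (h.w0.trans hn) hL hW).seq
    fun s₁ f₁ h₁ => Run.of_wp ?_ (Nat.le_of_ble_eq_true rfl)) (by omega) fun _ _ h => h
  rw [h.holds] at h₁
  refine ⟨?_, by simpa using h₁⟩
  have := count_le (n := n) fun x y => Holds s₀ i x y ∧ Holds s₀ j x y
  simp only [WExp.eval, h₁]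
  rw [mul_assoc] at hW
  omega

/-- Counts in `w 36` the pairs that satisfy the three constraints in real array `4`. -/
def tripleProg : Program :=
  crossProg ;; normProg ;; bitProg ;; store 0 0 30 ;; store 1 1 31 ;; store 2 2 32 ;;
    store 0 1 33 ;; store 0 2 34 ;; store 1 2 35 ;; combineProg

def slack (s : State) (i x y : ℕ) : ℝ :=
  s.ra 4 (3 * i) * (s.ra 0 x + s.ra 2 y) + s.ra 4 (3 * i + 1) * (s.ra 1 x + s.ra 3 y) -
    s.ra 4 (3 * i + 2)

theorem holds_eq : Holds s = fun i x y => 0 ≤ slack s i x y := by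
  funext i x y
  exact propext sub_nonneg.symm

theorem run_triple (hn : s.w 0 = n) (hL : n + n ≤ 2 ^ L)
    (hW : 8 * n * n + 4 * n + 5 < W) :
    Run W tripleProg s (L * (n * 3600 + 600) + n * 1200 + 2000) fun s' =>
      s'.w 36 = count n fun x y => Holds s 0 x y ∧ Holds s 1 x y ∧ Holds s 2 x y := by
  have hs : SameInput s s := ⟨rfl, rfl, rfl, rfl, rfl, rfl⟩
  have hW' : 8 * n * n + 4 * n + 1 < W := by omega
  rw [tripleProg]
  refine Run.mono (T₁ := _ + (_ + (_ + ((L * (n * 600 + 100) + n * 200 + 210) +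
      ((L * (n * 600 + 100) + n * 200 + 210) + ((L * (n * 600 + 100) + n * 200 + 210) +
      ((L * (n * 600 + 100) + n * 200 + 210) + ((L * (n * 600 + 100) + n * 200 + 210) +
      ((L * (n * 600 + 100) + n * 200 + 210) + 120)))))))))
    (run_cross.seq fun s₁ f₁ h₁ => (run_norm ?_ h₁.2).seq fun s₂ f₂ h₂ =>
    (run_bit (by omega)).seq fun s₃ f₃ h₃ => ?_) ?_ fun _ _ h => h
  · simpa only [IsDependency, f₁.ra 4 rfl] using h₁.1
  · have i₁ := hs.frame f₁ rfl rfl rfl rfl rfl rfl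
    have i₂ := i₁.frame f₂ rfl rfl rfl rfl rfl rfl
    have i₃ := i₂.frame f₃ rfl rfl rfl rfl rfl rfl
    refine (run_store 0 0 30 i₃ hn hL hW').seq fun s₄ f₄ h₄ => ?_
    have i₄ := i₃.frame f₄ rfl rfl rfl rfl rfl rfl
    refine (run_store 1 1 31 i₄ hn hL hW').seq fun s₅ f₅ h₅ => ?_
    have i₅ := i₄.frame f₅ rfl rfl rfl rfl rfl rfl
    refine (run_store 2 2 32 i₅ hn hL hW').seq fun s₆ f₆ h₆ => ?_
    have i₆ := i₅.frame f₆ rfl rfl rfl rfl rfl rfl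
    refine (run_store 0 1 33 i₆ hn hL hW').seq fun s₇ f₇ h₇ => ?_
    have i₇ := i₆.frame f₇ rfl rfl rfl rfl rfl rfl
    refine (run_store 0 2 34 i₇ hn hL hW').seq fun s₈ f₈ h₈ => ?_
    have i₈ := i₇.frame f₈ rfl rfl rfl rfl rfl rfl
    refine (run_store 1 2 35 i₈ hn hL hW').seq fun s₉ f₉ h₉ => ?_
    have i₉ := i₈.frame f₉ rfl rfl rfl rfl rfl rfl
    have e₀ := (f₉.w 30 rfl).trans ((f₈.w 30 rfl).trans ((f₇.w 30 rfl).trans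
      ((f₆.w 30 rfl).trans ((f₅.w 30 rfl).trans h₄))))
    have e₁ := (f₉.w 31 rfl).trans ((f₈.w 31 rfl).trans ((f₇.w 31 rfl).trans
      ((f₆.w 31 rfl).trans h₅)))
    have e₂ := (f₉.w 32 rfl).trans ((f₈.w 32 rfl).trans ((f₇.w 32 rfl).trans h₆))
    have e₃ := (f₉.w 33 rfl).trans ((f₈.w 33 rfl).trans h₇)
    have e₄ := (f₉.w 34 rfl).trans h₈
    have e₅ := (f₉.w 37 rfl).trans ((f₈.w 37 rfl).trans ((f₇.w 37 rfl).trans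
      ((f₆.w 37 rfl).trans ((f₅.w 37 rfl).trans ((f₄.w 37 rfl).trans h₃)))))
    refine (run_combine (n := n) (i₉.w0.trans hn) (by nlinarith) (by rw [e₃]; exact count_le _)
      (by rw [e₄]; exact count_le _) (by rw [h₉]; exact count_le _)).mono le_rfl fun s' _ h' => ?_
    rw [h', e₀, e₁, e₂, e₃, e₄, h₉]
    simp only [and_self, holds_eq]
    refine combine_eq_of_dependent (slack s 0) (slack s 1) (slack s 2) (fun x y => ?_) h₂.2 e₅
    have hd := h₂.1
    rw [IsDependency, f₁.ra 4 rfl] at hd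
    rw [i₂.ra4]
    simp only [slack, Nat.mul_zero, Nat.zero_add, Nat.mul_one, Nat.reduceMul, Nat.reduceAdd]
    -- The dependency of the normals cancels both coordinates of `p + q`; only the constant terms
    -- remain.
    linear_combination (s.ra 0 x + s.ra 2 y) * hd.1 + (s.ra 1 x + s.ra 3 y) * hd.2
  · ring_nf
    omega

end PairCount
end RealRAM

namespace RealRAM

namespace Selection

open MergeSort PairCount

/-! ## The halving step -/

variable {W n S : ℕ} {K : ℕ → ℝ} {A lo hi lo' hi' : ℕ → ℕ}

/-- The `x`-th item of the sorted list is a weighted median of the items below `n`. -/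
structure WeightedMedian (n S : ℕ) (wt A : ℕ → ℕ) (x : ℕ) : Prop where
  lt : x < n
  below : 2 * ∑ y ∈ Finset.range x, wt (A y) < S
  above : S ≤ 2 * ∑ y ∈ Finset.range (x + 1), wt (A y)

theorem WeightedMedian.le_sum_le {wt : ℕ → ℕ} {x : ℕ} (h : WeightedMedian n S wt A x)
    (hA : Sorted K id id n A) :
    S ≤ 2 * ∑ p ∈ Finset.range n, if K p ≤ K (A x) then wt p else 0 := by
  have e := hA.sum_eq fun p => if K p ≤ K (A x) then wt p else 0
  simp only [id] at e
  rw [← e]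
  refine h.above.trans (Nat.mul_le_mul_left 2 ?_)
  calc _ = ∑ y ∈ Finset.range (x + 1), if K (A y) ≤ K (A x) then wt (A y) else 0 := by
        refine Finset.sum_congr rfl fun y hy => (if_pos ?_).symm
        rcases Nat.lt_succ_iff_lt_or_eq.1 (Finset.mem_range.1 hy) with hl | rfl
        · rcases hA.sorted y x hl h.lt with hk | hk
          · exact hk.le
          · exact hk.1.le
        · exact le_rfl
    _ ≤ _ := Finset.sum_le_sum_of_subset (Finset.range_subset_range.2 h.lt)

/-- The items before the `x`-th carry less than half of the weight, and all others have keys at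
least `K (A x)`. -/
theorem WeightedMedian.le_sum_ge {wt : ℕ → ℕ} {x : ℕ} (h : WeightedMedian n S wt A x)
    (hA : Sorted K id id n A) (hS : S = ∑ p ∈ Finset.range n, wt p) :
    S ≤ 2 * ∑ p ∈ Finset.range n, if K (A x) ≤ K p then wt p else 0 := by
  have e := hA.sum_eq fun p => if K (A x) ≤ K p then wt p else 0
  have e' := hA.sum_eq wt
  simp only [id] at e e'
  rw [← e]
  have hle : ∑ y ∈ Finset.range n, wt (A y) ≤ ∑ y ∈ Finset.range x, wt (A y) +
      ∑ y ∈ Finset.range n, if K (A x) ≤ K (A y) then wt (A y) else 0 := by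
    rw [← Finset.sum_range_add_sum_Ico (fun y => wt (A y)) h.lt.le]
    refine Nat.add_le_add_left ?_ _
    calc _ = ∑ y ∈ Finset.Ico x n, if K (A x) ≤ K (A y) then wt (A y) else 0 := by
          refine Finset.sum_congr rfl fun y hy => (if_pos ?_).symm
          obtain ⟨h₁, h₂⟩ := Finset.mem_Ico.1 hy
          rcases h₁.lt_or_eq with hl | rfl
          · rcases hA.sorted x y hl h₂ with hk | hk
            · exact hk.le
            · exact hk.1.le
          · exact le_rfl
      _ ≤ _ := Finset.sum_le_sum_of_subset fun y hy =>
          Finset.mem_range.2 (Finset.mem_Ico.1 hy).2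
  have := h.below
  omega

/-- If every interval that satisfies `c` is at least halved, and the intervals that satisfy `c`
have at least half of the total length, then a quarter of the total length is lost. -/
theorem four_mul_sum_le {wt wt' : ℕ → ℕ} {c : ℕ → Prop} [DecidablePred c]
    (hS : S = ∑ p ∈ Finset.range n, wt p)
    (hc : S ≤ 2 * ∑ p ∈ Finset.range n, if c p then wt p else 0)
    (h : ∀ p < n, 2 * wt' p + (if c p then wt p else 0) ≤ 2 * wt p) :
    4 * ∑ p ∈ Finset.range n, wt' p ≤ 3 * S := by
  have := Finset.sum_le_sum fun p hp => h p (Finset.mem_range.1 hp)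
  rw [Finset.sum_add_distrib, ← Finset.mul_sum, ← Finset.mul_sum, ← hS] at this
  omega

/-! ## One round of the search -/

/-- Word arrays `2` and `3` hold the ends of the candidate interval of each row. -/
def width (s : State) (p : ℕ) : ℕ := s.wa 3 p - s.wa 2 p

/-- The value in the middle of the candidate interval of row `p`; real array `6` holds the values
of the first summands and real array `7` the sorted values of the second summands. -/
noncomputable def median (s : State) (p : ℕ) : ℝ :=
  s.ra 6 p + s.ra 7 ((s.wa 2 p + s.wa 3 p) / 2)

def mid (p : WExp) : WExp := .div (.add (.get 2 p) (.get 3 p)) (.lit 2)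

def medianProg : Program :=
  (.setW 10 (.var 0) ;; .setW 41 (.lit 0)) ;; .loop (.not (.wle (.var 0) (.var 41)))
    (.putW 0 (.var 41) (.var 41) ;;
      .putR 5 (.var 41) (.add (.get 6 (.var 41)) (.get 7 (mid (.var 41)))) ;;
      .putR 8 (.var 41) (.get 5 (.var 41)) ;; .setW 41 (.add (.var 41) (.lit 1)))

variable {s : State}

theorem run_median (hn : s.w 0 = n) (hW : n < W) :
    Run W medianProg s (n * 50 + 20) fun s' => s'.w 10 = n ∧
      ∀ p < n, s'.wa 0 p = p ∧ s'.ra 5 p = median s p ∧ s'.ra 8 p = median s p := by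
  have init : Run W (.setW 10 (.var 0) ;; .setW 41 (.lit 0)) s 5 fun s' =>
      s'.w 10 = n ∧ s'.w 41 = 0 := by
    refine Run.of_wp ⟨?_, ?_, ?_⟩ (by decide) <;> simp [hn] <;> omega
  refine (init.seq fun s₁ f₁ h₁ => Run.loop (s := s₁) n 40 (fun o s' => s'.w 41 = o ∧ o ≤ n ∧
    ∀ p < o, s'.wa 0 p = p ∧ s'.ra 5 p = median s p ∧ s'.ra 8 p = median s p) ?_ ?_
    ⟨h₁.2, by omega, fun x hx => by omega⟩).mono
    (by simp only [BExp.cost, WExp.cost]; omega) fun _ _ h => h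
  · rintro o s' hf ⟨ho, _, h⟩ hb
    simp only [BExp.Holds, WExp.eval, hf.w 0 rfl, f₁.w 0 rfl, hn] at hb
    refine ⟨by omega, Run.of_wp ?_ (by decide)⟩
    refine ⟨?_, ?_, ?_, ?_, ?_, ?_, ?_, ?_⟩ <;> simp [ho]
    · omega
    · omega
    · omega
    · omega
    · omega
    · omega
    · intro p hp
      have e : s'.ra 6 o + s'.ra 7 (WExp.eval (s'.putW 0 o o) (mid (.var 41))) = median s o := by
        simp [mid, median, ho, hf.ra 6 rfl, hf.ra 7 rfl, f₁.ra 6 rfl, f₁.ra 7 rfl, hf.wa 2 rfl,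
          hf.wa 3 rfl, f₁.wa 2 rfl, f₁.wa 3 rfl]
      rw [e]
      split_ifs with hpo
      · exact ⟨hpo.symm, by rw [hpo], by rw [hpo]⟩
      · exact h p (by omega)
  · rintro o s' hf ⟨ho, _, h⟩ hb
    simp only [BExp.Holds, WExp.eval, hf.w 0 rfl, f₁.w 0 rfl, hn] at hb
    exact ⟨(hf.w 10 rfl).trans h₁.1, fun x hx => h x (by omega)⟩

/-- Stores in `r 1` a weighted median of real array `8`, which word array `0` sorts. -/
def pickProg : Program :=
  (.setW 42 (.lit 0) ;; .setW 43 (.lit 0)) ;;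
    .loop (.not (.wle (.var 40) (.mul (.lit 2) (.var 42))))
    (.setW 42 (.add (.var 42) (.sub (.get 3 (.get 0 (.var 43))) (.get 2 (.get 0 (.var 43))))) ;;
      .setR 1 (.get 8 (.get 0 (.var 43))) ;; .setW 43 (.add (.var 43) (.lit 1)))

theorem run_pick (hn : s.w 0 = n) (hW : n + S + 1 < W) (hS : s.w 40 = S) (hS0 : 0 < S)
    (hsum : S = ∑ p ∈ Finset.range n, width s (s.wa 0 p)) :
    Run W pickProg s (n * 40 + 20) fun s' =>
      ∃ x, WeightedMedian n S (width s) (s.wa 0) x ∧ s'.r 1 = s.ra 8 (s.wa 0 x) := by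
  have init : Run W (.setW 42 (.lit 0) ;; .setW 43 (.lit 0)) s 5 fun s' =>
      s'.w 42 = 0 ∧ s'.w 43 = 0 := by
    refine Run.of_wp ⟨?_, ?_, ?_⟩ (by decide) <;> simp <;> omega
  have hle (i : ℕ) (hi : i ≤ n) : ∑ y ∈ Finset.range i, width s (s.wa 0 y) ≤ S := by
    rw [hsum]
    exact Finset.sum_le_sum_of_subset (Finset.range_subset_range.2 hi)
  -- The last consumed item `x = i - 1` is remembered together with the guard that held before it;
  -- when the loop stops, `x` is the weighted median.
  refine (init.seq fun s₁ f₁ h₁ => Run.loop (s := s₁) n 30 (fun i s' => s'.w 43 = i ∧ i ≤ n ∧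
    s'.w 42 = ∑ y ∈ Finset.range i, width s (s.wa 0 y) ∧ ∀ x, i = x + 1 →
      s'.r 1 = s.ra 8 (s.wa 0 x) ∧ 2 * ∑ y ∈ Finset.range x, width s (s.wa 0 y) < S) ?_ ?_
    ⟨h₁.2, by omega, by simpa using h₁.1, fun x hx => by omega⟩).mono
    (by simp only [BExp.cost, WExp.cost]; omega) fun _ _ h => h
  · rintro i s' hf ⟨hi, hin, hacc, h⟩ hb
    simp only [BExp.Holds, WExp.eval, hf.w 40 rfl, f₁.w 40 rfl, hS, hacc, not_le] at hb
    have hlt : i < n := by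
      rcases hin.lt_or_eq with hin | rfl
      · exact hin
      · omega
    have e : ∑ y ∈ Finset.range (i + 1), width s (s.wa 0 y) =
        s'.w 42 + (s'.wa 3 (s'.wa 0 i) - s'.wa 2 (s'.wa 0 i)) := by
      rw [Finset.sum_range_succ, hacc, hf.wa 3 rfl, hf.wa 2 rfl, hf.wa 0 rfl, f₁.wa 3 rfl,
        f₁.wa 2 rfl, f₁.wa 0 rfl, width]
    have := hle (i + 1) hlt
    refine ⟨hlt, Run.of_wp ?_ (by decide)⟩
    refine ⟨?_, ?_, ?_⟩
    · simp [hi]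
      omega
    · simp [hi]
      omega
    · refine ⟨by simp [hi], hlt, by simp [hi, e], ?_⟩
      rintro x hx
      obtain rfl : x = i := by omega
      refine ⟨?_, hb⟩
      simp [hi, hf.ra 8 rfl, hf.wa 0 rfl, f₁.ra 8 rfl, f₁.wa 0 rfl]
  · rintro i s' hf ⟨hi, hin, hacc, h⟩ hb
    simp only [BExp.Holds, WExp.eval, hf.w 40 rfl, f₁.w 40 rfl, hS, hacc, not_not] at hb
    obtain _ | x := i
    · simp at hb
      omega
    · obtain ⟨h₂, h₃⟩ := h x rfl
      exact ⟨x, ⟨by omega, h₃, hb⟩, h₂⟩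

/-- Records in `r 0` the largest value that at least `k` pairs reach; `w 44` tells whether there is
one yet. -/
def bestProg : Program :=
  .branch (.and (.wle (.var 1) (.var 36))
      (.not (.and (.wle (.lit 1) (.var 44)) (.not (.rle (.var 0) (.var 1))))))
    (.setR 0 (.var 1) ;; .setW 44 (.lit 1)) .skip

/-- If at least `k` pairs reach the pivot, rows with median at most the pivot drop their lower part;
otherwise rows with median at least the pivot drop their upper part. The median itself is always
dropped, which guarantees halving for intervals of length one too; `bestProg` compensates for a lost
answer. Empty intervals are skipped. -/
def shrinkProg : Program :=
  (.setW 41 (.lit 0) ;; .setW 40 (.lit 0)) ;; .loop (.not (.wle (.var 0) (.var 41)))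
    (.branch (.not (.wle (.get 3 (.var 41)) (.get 2 (.var 41))))
      (.branch (.wle (.var 1) (.var 36))
        (.branch (.rle (.get 8 (.var 41)) (.var 1))
          (.putW 2 (.var 41) (.add (mid (.var 41)) (.lit 1))) .skip)
        (.branch (.rle (.var 1) (.get 8 (.var 41)))
          (.putW 3 (.var 41) (mid (.var 41))) .skip)) .skip ;;
      .setW 40 (.add (.var 40) (.sub (.get 3 (.var 41)) (.get 2 (.var 41)))) ;;
      .setW 41 (.add (.var 41) (.lit 1)))

open Classical in
noncomputable def newLo (s : State) (p : ℕ) : ℕ :=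
  if s.wa 2 p < s.wa 3 p ∧ s.w 1 ≤ s.w 36 ∧ s.ra 8 p ≤ s.r 1 then
    (s.wa 2 p + s.wa 3 p) / 2 + 1 else s.wa 2 p

open Classical in
noncomputable def newHi (s : State) (p : ℕ) : ℕ :=
  if s.wa 2 p < s.wa 3 p ∧ s.w 36 < s.w 1 ∧ s.r 1 ≤ s.ra 8 p then
    (s.wa 2 p + s.wa 3 p) / 2 else s.wa 3 p

theorem newHi_le (s : State) (p : ℕ) : newHi s p ≤ s.wa 3 p := by
  unfold newHi
  split_ifs <;> omega

theorem run_shrink (hn : s.w 0 = n) (hhi : ∀ p < n, s.wa 3 p ≤ n) (hW : n * n + n + 1 < W) :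
    Run W shrinkProg s (n * 100 + 20) fun s' =>
      (∀ p < n, s'.wa 2 p = newLo s p ∧ s'.wa 3 p = newHi s p) ∧
      s'.w 40 = ∑ p ∈ Finset.range n, (newHi s p - newLo s p) := by
  have init : Run W (.setW 41 (.lit 0) ;; .setW 40 (.lit 0)) s 5 fun s' =>
      s'.w 41 = 0 ∧ s'.w 40 = 0 := by
    refine Run.of_wp ⟨?_, ?_, ?_⟩ (by decide) <;> simp <;> omega
  have hle (i : ℕ) (hi : i ≤ n) : ∑ p ∈ Finset.range i, (newHi s p - newLo s p) ≤ n * n := by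
    refine (Finset.sum_le_card_nsmul _ _ n fun p hp => ?_).trans ?_
    · have := newHi_le s p
      have := hhi p ((Finset.mem_range.1 hp).trans_le hi)
      omega
    · simp only [Finset.card_range, smul_eq_mul]
      exact Nat.mul_le_mul_right n hi
  refine (init.seq fun s₁ f₁ h₁ => Run.loop (s := s₁) n 90 (fun i s' => s'.w 41 = i ∧ i ≤ n ∧
    s'.w 40 = ∑ p ∈ Finset.range i, (newHi s p - newLo s p) ∧
    (∀ p < i, s'.wa 2 p = newLo s p ∧ s'.wa 3 p = newHi s p) ∧
    ∀ p, i ≤ p → s'.wa 2 p = s.wa 2 p ∧ s'.wa 3 p = s.wa 3 p) ?_ ?_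
    ⟨h₁.1, by omega, by simpa using h₁.2, fun x hx => by omega, fun p _ =>
      by rw [f₁.wa 2 rfl, f₁.wa 3 rfl]; simp⟩).mono
    (by simp only [BExp.cost, WExp.cost]; omega) fun _ _ h => h
  · rintro i s' hf ⟨hi, hin, hacc, hdone, htodo⟩ hb
    have e0 : s'.w 0 = n := ((hf.w 0 rfl).trans (f₁.w 0 rfl)).trans hn
    simp only [BExp.Holds, WExp.eval, e0] at hb
    have hlt : i < n := by omega
    have el := (htodo i le_rfl).1
    have eh := (htodo i le_rfl).2
    have e1 : s'.w 1 = s.w 1 := (hf.w 1 rfl).trans (f₁.w 1 rfl)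
    have e36 : s'.w 36 = s.w 36 := (hf.w 36 rfl).trans (f₁.w 36 rfl)
    have er : s'.r 1 = s.r 1 := (hf.r 1 rfl).trans (f₁.r 1 rfl)
    have e8 : s'.ra 8 = s.ra 8 := (hf.ra 8 rfl).trans (f₁.ra 8 rfl)
    have hhi' := hhi i hlt
    refine ⟨hlt, Run.mono (T₁ := 70 + 20) (Run.seq (R := fun s₂ => s₂.wa 2 i = newLo s i ∧
      s₂.wa 3 i = newHi s i ∧ ∀ p ≠ i, s₂.wa 2 p = s'.wa 2 p ∧ s₂.wa 3 p = s'.wa 3 p)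
      (Run.of_wp ?_ (by decide)) fun s₂ f₂ h₂ => Run.of_wp ?_ (by decide)) le_rfl fun _ _ h => h⟩
    · simp only [Program.wp, BExp.Holds, WExp.eval, RExp.eval, mid, hi, el, eh, e1, e36, er, e8,
        not_le, State.putW_wa, newLo, newHi]
      refine ⟨fun h₁ => ⟨fun h₂ => ⟨fun h₃ => ?_, fun h₃ => ?_⟩, fun h₂ => ⟨fun h₃ => ?_,
        fun h₃ => ?_⟩⟩, fun h₁ => ?_⟩
      · refine ⟨by omega, by omega, ?_, ?_, fun p hp => ?_⟩
        · simp [h₁, h₂, h₃]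
        · simp [not_lt.2 h₂]
        · simp [hp]
      · simp only [not_le.2 h₃, not_lt.2 h₂, and_false, false_and, if_false]
        simp
      · refine ⟨by omega, by omega, ?_, ?_, fun p hp => ?_⟩
        · simp [not_le.2 h₂]
        · simp [h₁, h₂, h₃]
        · simp [hp]
      · simp only [not_le.2 h₃, not_le.2 h₂, and_false, false_and, if_false]
        simp
      · simp only [h₁, false_and, if_false]
        simp
    · have hnew := hle (i + 1) hlt
      rw [Finset.sum_range_succ, ← hacc, ← h₂.1, ← h₂.2.1, ← f₂.w 40 rfl] at hnew
      have e41 : s₂.w 41 = i := (f₂.w 41 rfl).trans hi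
      refine ⟨?_, ?_, ?_, hlt, ?_, fun p hp => ?_, fun p hp => ?_⟩ <;> simp [e41]
      · omega
      · omega
      · rw [Finset.sum_range_succ, ← hacc, h₂.1, h₂.2.1, f₂.w 40 rfl]
      · rcases Nat.lt_succ_iff_lt_or_eq.1 hp with hp | rfl
        · rw [(h₂.2.2 p hp.ne).1, (h₂.2.2 p hp.ne).2]
          exact hdone p hp
        · exact ⟨h₂.1, h₂.2.1⟩
      · rw [(h₂.2.2 p (by omega)).1, (h₂.2.2 p (by omega)).2]
        exact htodo p (by omega)
  · rintro i s' hf ⟨hi, hin, hacc, hdone, htodo⟩ hb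
    simp only [BExp.Holds, WExp.eval, hf.w 0 rfl, f₁.w 0 rfl, hn] at hb
    obtain rfl : i = n := by omega
    exact ⟨hdone, hacc⟩

end Selection
end RealRAM

namespace RealRAM

namespace Selection

open MergeSort PairCount

/-! ### Correctness of one round and the number of rounds. -/

variable {W n L : ℕ} {s : State} {v : ℝ}

theorem run_best (hW : 1 < W) : Run W bestProg s 40 fun s' =>
    (s.w 1 ≤ s.w 36 → s'.w 44 ≠ 0 ∧ ((s.w 44 ≠ 0 → s.r 0 ≤ s.r 1) ∧ s'.r 0 = s.r 1 ∨
      s.w 44 ≠ 0 ∧ s.r 1 < s.r 0 ∧ s'.r 0 = s.r 0)) ∧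
    (s.w 36 < s.w 1 → s'.w 44 = s.w 44 ∧ s'.r 0 = s.r 0) := by
  refine Run.of_wp ⟨fun hb => ⟨hW, ?_⟩, fun hb => ?_⟩ (by decide) <;>
    simp only [BExp.Holds, WExp.eval, RExp.eval] at hb
  · simp only [State.setW_w, State.setR_w, State.setW_r, State.setR_r, if_true, WExp.eval]
    refine ⟨fun _ => ⟨one_ne_zero, .inl ⟨fun h => ?_, rfl⟩⟩, fun h => absurd hb.1 (not_le.2 h)⟩
    by_contra hlt
    exact hb.2 ⟨by omega, hlt⟩
  · refine ⟨fun h => ?_, fun _ => ⟨rfl, rfl⟩⟩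
    have h' := not_not.1 fun hn => hb ⟨h, hn⟩
    exact ⟨by omega, .inr ⟨by omega, not_le.1 h'.2, rfl⟩⟩

/-- The value of the objective function at the pair `(x, y)`. -/
def objective (s : State) (x y : ℕ) : ℝ :=
  s.ra 4 6 * (s.ra 0 x + s.ra 2 y) + s.ra 4 7 * (s.ra 1 x + s.ra 3 y)

/-- `v` is the `w 1`-th largest objective value of the feasible pairs. -/
def IsAnswer (n : ℕ) (s : State) (v : ℝ) : Prop :=
  ∀ t, s.w 1 ≤ count n (fun x y => Holds s 0 x y ∧ Holds s 1 x y ∧ t ≤ objective s x y) ↔ t ≤ v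

/-- The invariant of the search for `v` after `i` rounds. -/
structure SearchInv (n : ℕ) (v : ℝ) (i : ℕ) (s : State) : Prop where
  hi_le : ∀ p < n, s.wa 3 p ≤ n
  total : s.w 40 = ∑ p ∈ Finset.range n, width s p
  shrunk : 4 ^ i * s.w 40 ≤ 3 ^ i * (n * n)
  best_le : s.w 44 ≠ 0 → s.r 0 ≤ v
  reach : s.w 44 ≠ 0 ∧ s.r 0 = v ∨
    ∃ p < n, ∃ j, s.wa 2 p ≤ j ∧ j < s.wa 3 p ∧ s.ra 6 p + s.ra 7 j = v

/-- Six rounds reduce the total by a factor of at least four, as `3 ^ 6 * 4 = 2916 ≤ 4096 = 4 ^ 6`,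
and initially it is at most `4 ^ L`. -/
theorem rounds_lt {i S : ℕ} (h : 4 ^ i * S ≤ 3 ^ i * (n * n)) (hS : 0 < S) (hn : n ≤ 2 ^ L) :
    i < 6 * L + 1 := by
  by_contra hi
  obtain ⟨d, rfl⟩ := Nat.exists_eq_add_of_le (not_lt.1 hi)
  have h₁ : n * n ≤ 4 ^ L := by
    calc n * n ≤ 2 ^ L * 2 ^ L := Nat.mul_le_mul hn hn
      _ = 4 ^ L := by rw [← mul_pow]; norm_num
  have h₂ : 3 ^ (6 * L) * 4 ^ L ≤ 4 ^ (6 * L) := by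
    rw [pow_mul, pow_mul, ← mul_pow]
    exact Nat.pow_le_pow_left (by norm_num) L
  have h₃ : 3 ^ (1 + d) < 4 ^ (1 + d) := Nat.pow_lt_pow_left (by norm_num) (by omega)
  have h₄ : 4 ^ (6 * L + 1 + d) ≤ 3 ^ (6 * L + 1 + d) * 4 ^ L :=
    (Nat.le_mul_of_pos_right _ hS).trans (h.trans (Nat.mul_le_mul_left _ h₁))
  have h₅ : 3 ^ (6 * L + 1 + d) * 4 ^ L < 4 ^ (6 * L + 1 + d) := by
    calc 3 ^ (6 * L + 1 + d) * 4 ^ L = 3 ^ (6 * L) * 4 ^ L * 3 ^ (1 + d) := by ring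
      _ ≤ 4 ^ (6 * L) * 3 ^ (1 + d) := Nat.mul_le_mul_right _ h₂
      _ < 4 ^ (6 * L) * 4 ^ (1 + d) := Nat.mul_lt_mul_of_pos_left h₃ (by positivity)
      _ = 4 ^ (6 * L + 1 + d) := by ring
  omega

/-- The objective coefficients sit at addresses `6` and `7`, so writing the pivot to address `8`
turns "value at least the pivot" into constraint number `2` for `tripleProg`. -/
def roundProg : Program :=
  medianProg ;; MergeSort.prog ;; pickProg ;; .putR 4 (.lit 8) (.var 1) ;; tripleProg ;;
    bestProg ;; shrinkProg

/-- In both outcomes of the count, the rows that are cut hold at least half of the total by the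
weighted median property, and each at least halves. -/
theorem four_mul_shrunk_le {wt : ℕ → ℕ} {S : ℕ} {s₆ : State} {t : ℝ} {A : ℕ → ℕ} {K : ℕ → ℝ}
    {x : ℕ} (hA : Sorted K id id n A) (hx : WeightedMedian n S wt A x) (ht : t = K (A x))
    (hK : ∀ p < n, s₆.ra 8 p = K p) (hr : s₆.r 1 = t) (hwt : wt = width s₆)
    (hS : S = ∑ p ∈ Finset.range n, wt p) :
    4 * ∑ p ∈ Finset.range n, (newHi s₆ p - newLo s₆ p) ≤ 3 * S := by
  classical
  subst hwt
  by_cases hk : s₆.w 1 ≤ s₆.w 36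
  · refine four_mul_sum_le hS (hx.le_sum_le hA) fun p hp => ?_
    rw [newHi, newLo, hr, hK p hp, ← ht, width]
    by_cases hlt : s₆.wa 2 p < s₆.wa 3 p <;> by_cases hc : K p ≤ t <;>
      simp only [hlt, hk, hc, not_lt.2 hk, false_and, and_false, and_self, if_true,
        if_false] <;> omega
  · refine four_mul_sum_le hS (hx.le_sum_ge hA hS) fun p hp => ?_
    rw [newHi, newLo, hr, hK p hp, ← ht, width]
    have hk' := not_le.1 hk
    by_cases hlt : s₆.wa 2 p < s₆.wa 3 p <;> by_cases hc : t ≤ K p <;>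
      simp only [hlt, hk, hk', hc, false_and, and_false, and_self, if_true,
        if_false] <;> omega

theorem run_round {i : ℕ} (hn : s.w 0 = n) (hL : n + n ≤ 2 ^ L)
    (hW : 8 * n * n + 4 * n + 5 < W) (hsort : ∀ j j', j ≤ j' → j' < n → s.ra 7 j ≤ s.ra 7 j')
    (hv : IsAnswer n s v) (h : SearchInv n v i s) (hS : 0 < s.w 40) :
    Run W roundProg s (L * (n * 3750 + 650) + n * 1400 + 2200) fun s' =>
      SearchInv n v (i + 1) s' ∧ ∀ k < 8, s'.ra 4 k = s.ra 4 k := by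
  have hnn : 8 * n * n = 8 * (n * n) := mul_assoc _ _ _
  have hSle : s.w 40 ≤ n * n := by
    rw [h.total]
    refine (Finset.sum_le_card_nsmul _ _ n fun p hp => ?_).trans (by simp)
    have := h.hi_le p (Finset.mem_range.1 hp)
    unfold width
    omega
  rw [roundProg]
  refine Run.mono (T₁ := _ + (_ + (_ + (5 + (_ + (_ + _))))))
    ((run_median hn (by omega)).seq fun s₁ f₁ h₁ =>
    (MergeSort.run_prog (pos := id) (n := n) (L := L) h₁.1 ((f₁.w 0 rfl).trans hn) (by omega) rfl
      (by nlinarith) (fun x hx => by rw [(h₁.2 x hx).1]; omega)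
      (fun x hx => by rw [(h₁.2 x hx).1]; rfl)).seq fun s₂ f₂ h₂ =>
    (run_pick (n := n) (S := s.w 40) (((f₂.w 0 rfl).trans (f₁.w 0 rfl)).trans hn) (by omega)
      ((f₂.w 40 rfl).trans (f₁.w 40 rfl)) hS ?_).seq fun s₃ f₃ h₃ =>
    (Run.of_wp (Q := fun s₄ => s₄.ra 4 8 = s₃.r 1 ∧ ∀ k < 8, s₄.ra 4 k = s₃.ra 4 k) ?_
      (T := 5) (by decide)).seq fun s₄ f₄ h₄ =>
    (run_triple (n := n) (L := L) ?_ hL hW).seq fun s₅ f₅ h₅ => (run_best (by omega)).seq fun s₆ f₆ h₆ =>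
    (run_shrink (W := W) (n := n) ?_ ?_ (by omega)).mono le_rfl fun s₇ f₇ h₇ => ?_) ?_
    fun _ _ h => h
  · have e₂ : width s₂ = width s := by
      unfold width
      rw [f₂.wa 2 rfl, f₂.wa 3 rfl, f₁.wa 2 rfl, f₁.wa 3 rfl]
    rw [h.total, e₂, h₂.1.sum_eq]
    exact Finset.sum_congr rfl fun p hp => by rw [(h₁.2 p (Finset.mem_range.1 hp)).1]
  · refine ⟨?_, ?_, fun k hk => ?_⟩
    · simp only [WExp.eval]
      omega
    · simp
    · simp [hk.ne]
  · rw [f₄.w 0 rfl, f₃.w 0 rfl, f₂.w 0 rfl, f₁.w 0 rfl, hn]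
  · rw [f₆.w 0 rfl, f₅.w 0 rfl, f₄.w 0 rfl, f₃.w 0 rfl, f₂.w 0 rfl, f₁.w 0 rfl, hn]
  · rw [f₆.wa 3 rfl, f₅.wa 3 rfl, f₄.wa 3 rfl, f₃.wa 3 rfl, f₂.wa 3 rfl, f₁.wa 3 rfl]
    exact h.hi_le
  · have hsorted : Sorted (s₁.ra 5) id id n (s₂.wa 0) := by
      refine ⟨h₂.1.mem, fun x hx => ?_, h₂.1.sorted⟩
      have := h₂.1.img x hx
      rwa [(h₁.2 _ (h₂.1.mem x hx)).1] at this
    have e2 : s₆.wa 2 = s.wa 2 := by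
      rw [f₆.wa 2 rfl, f₅.wa 2 rfl, f₄.wa 2 rfl, f₃.wa 2 rfl, f₂.wa 2 rfl, f₁.wa 2 rfl]
    have e3 : s₆.wa 3 = s.wa 3 := by
      rw [f₆.wa 3 rfl, f₅.wa 3 rfl, f₄.wa 3 rfl, f₃.wa 3 rfl, f₂.wa 3 rfl, f₁.wa 3 rfl]
    have e8 : s₆.ra 8 = s₁.ra 8 := by
      rw [f₆.ra 8 rfl, f₅.ra 8 rfl, f₄.ra 8 rfl, f₃.ra 8 rfl, f₂.ra 8 rfl]
    have e44 : s₅.w 44 = s.w 44 := by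
      rw [f₅.w 44 rfl, f₄.w 44 rfl, f₃.w 44 rfl, f₂.w 44 rfl, f₁.w 44 rfl]
    have e0 : s₅.r 0 = s.r 0 := by
      rw [f₅.r 0 rfl, f₄.r 0 rfl, f₃.r 0 rfl, f₂.r 0 rfl, f₁.r 0 rfl]
    have e1 : s₅.w 1 = s.w 1 := by
      rw [f₅.w 1 rfl, f₄.w 1 rfl, f₃.w 1 rfl, f₂.w 1 rfl, f₁.w 1 rfl]
    have er : s₅.r 1 = s₃.r 1 := by rw [f₅.r 1 rfl, f₄.r 1 rfl]
    have ecoef : ∀ k < 8, s₄.ra 4 k = s.ra 4 k := fun k hk => by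
      rw [h₄.2 k hk, f₃.ra 4 rfl, f₂.ra 4 rfl, f₁.ra 4 rfl]
    obtain ⟨x, hx, ht⟩ := h₃
    rw [f₂.ra 8 rfl] at ht
    have hwd : width s₂ = width s₆ := by
      unfold width
      rw [e2, e3, f₂.wa 2 rfl, f₂.wa 3 rfl, f₁.wa 2 rfl, f₁.wa 3 rfl]
    have hwd' : width s₆ = width s := by
      unfold width
      rw [e2, e3]
    have hAx : s₂.wa 0 x < n := hsorted.mem x hx.lt
    have hfour := four_mul_shrunk_le hsorted hx (t := s₃.r 1) (s₆ := s₆)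
      (by rw [ht, (h₁.2 _ hAx).2.1, (h₁.2 _ hAx).2.2])
      (fun p hp => by rw [e8, (h₁.2 p hp).2.1, (h₁.2 p hp).2.2]) (by rw [f₆.r 1 rfl, er]) hwd
      (by rw [hwd, hwd', h.total])
    -- the count decides on which side of the pivot the answer lies
    have hside : s₅.w 1 ≤ s₅.w 36 ↔ s₃.r 1 ≤ v := by
      rw [← hv, e1, h₅]
      refine iff_of_eq (congrArg _ (count_congr fun x y => ?_))
      have a₀ : s₄.ra 0 = s.ra 0 := by rw [f₄.ra 0 rfl, f₃.ra 0 rfl, f₂.ra 0 rfl, f₁.ra 0 rfl]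
      have a₁ : s₄.ra 1 = s.ra 1 := by rw [f₄.ra 1 rfl, f₃.ra 1 rfl, f₂.ra 1 rfl, f₁.ra 1 rfl]
      have a₂ : s₄.ra 2 = s.ra 2 := by rw [f₄.ra 2 rfl, f₃.ra 2 rfl, f₂.ra 2 rfl, f₁.ra 2 rfl]
      have a₃ : s₄.ra 3 = s.ra 3 := by rw [f₄.ra 3 rfl, f₃.ra 3 rfl, f₂.ra 3 rfl, f₁.ra 3 rfl]
      simp only [PairCount.Holds, objective, Nat.mul_zero, Nat.zero_add, Nat.mul_one,
        Nat.reduceMul, Nat.reduceAdd, a₀, a₁, a₂, a₃, h₄.1, ecoef 0 (by norm_num),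
        ecoef 1 (by norm_num), ecoef 2 (by norm_num), ecoef 3 (by norm_num),
        ecoef 4 (by norm_num), ecoef 5 (by norm_num), ecoef 6 (by norm_num),
        ecoef 7 (by norm_num)]
    have hbest : (s₆.w 44 ≠ 0 → s₆.r 0 ≤ v) ∧
        (s.w 44 ≠ 0 ∧ s.r 0 = v → s₆.w 44 ≠ 0 ∧ s₆.r 0 = v) := by
      rcases le_or_gt (s₅.w 1) (s₅.w 36) with hk | hk
      · have htv := hside.1 hk
        obtain ⟨h₈, h₉⟩ := h₆.1 hk
        rw [er, e0, e44] at h₉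
        rcases h₉ with ⟨h₁₂, h₉⟩ | ⟨h₉, h₁₀, h₁₁⟩
        · refine ⟨fun _ => h₉ ▸ htv, fun ⟨h₁₀, h₁₁⟩ => ⟨h₈, ?_⟩⟩
          rw [h₉]
          exact le_antisymm htv (h₁₁ ▸ h₁₂ h₁₀)
        · exact ⟨fun _ => h₁₁ ▸ h.best_le h₉, fun hc => ⟨h₈, h₁₁.trans hc.2⟩⟩
      · obtain ⟨h₈, h₉⟩ := h₆.2 hk
        rw [h₈, h₉, e44, e0]
        exact ⟨h.best_le, fun hc => hc⟩
    refine ⟨⟨fun p hp => ?_, ?_, ?_, ?_, ?_⟩, fun k hk => ?_⟩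
    · rw [(h₇.1 p hp).2]
      exact (newHi_le _ _).trans (e3 ▸ h.hi_le p hp)
    · rw [h₇.2]
      refine Finset.sum_congr rfl fun p hp => ?_
      rw [width, (h₇.1 p (Finset.mem_range.1 hp)).1, (h₇.1 p (Finset.mem_range.1 hp)).2]
    · rw [h₇.2, pow_succ, pow_succ]
      have := h.shrunk
      nlinarith [pow_pos (show 0 < 4 by norm_num) i]
    · rw [f₇.w 44 rfl, f₇.r 0 rfl]
      exact hbest.1
    · rw [f₇.w 44 rfl, f₇.r 0 rfl]
      by_cases hfound : s₆.w 44 ≠ 0 ∧ s₆.r 0 = v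
      · exact .inl hfound
      refine .inr ?_
      obtain ⟨p, hp, j, hj₁, hj₂, hj⟩ := h.reach.resolve_left fun hc => hfound (hbest.2 hc)
      refine ⟨p, hp, j, ?_, ?_, ?_⟩
      · rw [(h₇.1 p hp).1, newLo, e2, e3]
        split_ifs with hc
        -- If the entry of value `v` is cut off here, then `v ≤ median ≤ pivot ≤ v`. So the pivot
        -- equals `v` and has just been recorded, since no earlier record exceeds `v`.
        · by_contra hjm
          obtain ⟨_, hk, hm⟩ := hc
          have hk' : s₅.w 1 ≤ s₅.w 36 := by rwa [f₆.w 1 rfl, f₆.w 36 rfl] at hk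
          have hm' : median s p ≤ s₃.r 1 := by
            rwa [e8, (h₁.2 p hp).2.2, f₆.r 1 rfl, er] at hm
          have hs := hsort j ((s.wa 2 p + s.wa 3 p) / 2) (by omega)
            (by have := h.hi_le p hp; omega)
          have hvt : s₃.r 1 = v := le_antisymm (hside.1 hk') (by
            rw [← hj]
            exact (add_le_add_right hs _).trans hm')
          obtain ⟨h₈, h₉⟩ := h₆.1 hk'
          rw [er, e0, e44] at h₉
          rcases h₉ with ⟨_, h₉⟩ | ⟨h₉, h₁₀, _⟩
          · exact hfound ⟨h₈, h₉.trans hvt⟩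
          · exact absurd (h.best_le h₉) (not_le.2 (hvt ▸ h₁₀))
        · exact hj₁
      · rw [(h₇.1 p hp).2, newHi, e2, e3]
        split_ifs with hc
        -- Too few pairs reach the pivot, so `v` is below it, whereas a removed entry is at least
        -- the median and hence at least the pivot.
        · by_contra hjm
          obtain ⟨_, hk, hm⟩ := hc
          have hk' : s₅.w 36 < s₅.w 1 := by rwa [f₆.w 1 rfl, f₆.w 36 rfl] at hk
          have hm' : s₃.r 1 ≤ median s p := by
            rwa [e8, (h₁.2 p hp).2.2, f₆.r 1 rfl, er] at hm
          have hs := hsort ((s.wa 2 p + s.wa 3 p) / 2) j (by omega)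
            (by have := h.hi_le p hp; omega)
          refine absurd (hside.2 ?_) (not_le.2 hk')
          rw [← hj]
          exact hm'.trans (add_le_add_right hs _)
        · exact hj₂
      · rw [f₇.ra 6 rfl, f₇.ra 7 rfl, f₆.ra 6 rfl, f₆.ra 7 rfl, f₅.ra 6 rfl, f₅.ra 7 rfl,
          f₄.ra 6 rfl, f₄.ra 7 rfl, f₃.ra 6 rfl, f₃.ra 7 rfl, f₂.ra 6 rfl, f₂.ra 7 rfl,
          f₁.ra 6 rfl, f₁.ra 7 rfl, hj]
    · rw [f₇.ra 4 rfl, f₆.ra 4 rfl, f₅.ra 4 rfl, ecoef k hk]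
  · ring_nf
    omega

end Selection
end RealRAM

namespace RealRAM

namespace MergeSort

/-! ### The complete search. -/

theorem Sorted.exists_eq {K : ℕ → ℝ} {pos A₀ A : ℕ → ℕ} {m y : ℕ} (h : Sorted K pos A₀ m A)
    (hy : y < m) : ∃ x < m, A x = A₀ y := by
  have e := h.sum_eq fun a => if a = A₀ y then 1 else 0
  have hpos : 0 < ∑ x ∈ Finset.range m, if A₀ x = A₀ y then 1 else 0 :=
    Finset.sum_pos' (fun _ _ => Nat.zero_le _) ⟨y, Finset.mem_range.2 hy, by simp⟩
  rw [← e] at hpos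
  obtain ⟨x, hx, hne⟩ := Finset.exists_ne_zero_of_sum_ne_zero hpos.ne'
  exact ⟨x, Finset.mem_range.1 hx, by by_contra hc; simp [hc] at hne⟩

end MergeSort

namespace Selection

open MergeSort PairCount

variable {W n L : ℕ} {s : State} {v : ℝ}

def searchProg : Program := .loop (.wle (.lit 1) (.var 40)) roundProg

theorem IsAnswer.congr {s' : State} (h : IsAnswer n s v) (hw : s'.w 1 = s.w 1)
    (h0 : s'.ra 0 = s.ra 0) (h1 : s'.ra 1 = s.ra 1) (h2 : s'.ra 2 = s.ra 2)
    (h3 : s'.ra 3 = s.ra 3) (h4 : ∀ k < 8, s'.ra 4 k = s.ra 4 k) : IsAnswer n s' v := by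
  intro t
  rw [← h t, hw]
  refine iff_of_eq (congrArg _ (count_congr fun x y => ?_))
  simp only [PairCount.Holds, objective, Nat.mul_zero, Nat.zero_add, Nat.mul_one, h0, h1, h2, h3,
    h4 0 (by norm_num), h4 1 (by norm_num), h4 2 (by norm_num), h4 3 (by norm_num),
    h4 4 (by norm_num), h4 5 (by norm_num), h4 6 (by norm_num), h4 7 (by norm_num)]

/-- When no candidate is left, `reach` says that `v` has been recorded. Only addresses below `8` of
real array `4` are preserved, because each round overwrites the pivot. -/
theorem run_search (hn : s.w 0 = n) (hL : n + n ≤ 2 ^ L)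
    (hW : 8 * n * n + 4 * n + 5 < W) (hsort : ∀ j j', j ≤ j' → j' < n → s.ra 7 j ≤ s.ra 7 j')
    (hv : IsAnswer n s v) (h : SearchInv n v 0 s) :
    Run W searchProg s ((6 * L + 1) * (L * (n * 3750 + 650) + n * 1400 + 2210) + 10)
      fun s' => s'.r 0 = v := by
  refine (Run.loop (6 * L + 1) (L * (n * 3750 + 650) + n * 1400 + 2200)
    (fun i s' => SearchInv n v i s' ∧ ∀ k < 8, s'.ra 4 k = s.ra 4 k) ?_ ?_
    ⟨h, fun _ _ => rfl⟩).mono ?_ fun _ _ h => h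
  · rintro i s' hf ⟨hi, hc⟩ hb
    simp only [BExp.Holds, WExp.eval] at hb
    refine ⟨rounds_lt hi.shrunk hb (by omega), (run_round ((hf.w 0 rfl).trans hn) hL hW
      (by rw [hf.ra 7 rfl]; exact hsort) (hv.congr (hf.w 1 rfl) (hf.ra 0 rfl) (hf.ra 1 rfl)
        (hf.ra 2 rfl) (hf.ra 3 rfl) hc) hi hb).mono le_rfl fun s₂ _ h₂ =>
      ⟨h₂.1, fun k hk => (h₂.2 k hk).trans (hc k hk)⟩⟩
  · rintro i s' hf ⟨hi, hc⟩ hb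
    simp only [BExp.Holds, WExp.eval] at hb
    rcases hi.reach with hr | ⟨p, hp, j, h₁, h₂, _⟩
    · exact hr.2
    · have hz : ∑ p ∈ Finset.range n, width s' p = 0 := by rw [← hi.total]; omega
      have := Finset.sum_eq_zero_iff.1 hz p (Finset.mem_range.2 hp)
      unfold width at this
      omega
  · have key (M X : ℕ) : M * (X + 2200 + 3 + 1) + 3 + 1 ≤ M * (X + 2210) + 10 := by nlinarith
    rw [show (BExp.wle (.lit 1) (.var 40)).cost = 3 from rfl]
    exact key (6 * L + 1) (L * (n * 3750 + 650) + n * 1400)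

/-! ## The initialization -/

/-- The value of the objective function at the `y`-th second summand. -/
def valueQ (s : State) (y : ℕ) : ℝ := s.ra 4 6 * s.ra 2 y + s.ra 4 7 * s.ra 3 y

def valueP (s : State) (x : ℕ) : ℝ := s.ra 4 6 * s.ra 0 x + s.ra 4 7 * s.ra 1 x

def valuesProg : Program :=
  (.setW 10 (.var 0) ;; .setW 41 (.lit 0)) ;; .loop (.not (.wle (.var 0) (.var 41)))
    (.putW 0 (.var 41) (.var 41) ;; .putW 2 (.var 41) (.lit 0) ;; .putW 3 (.var 41) (.var 0) ;;
      .putR 5 (.var 41) (.add (.mul (coef 6) (.get 2 (.var 41)))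
        (.mul (coef 7) (.get 3 (.var 41)))) ;;
      .putR 6 (.var 41) (.add (.mul (coef 6) (.get 0 (.var 41)))
        (.mul (coef 7) (.get 1 (.var 41)))) ;;
      .setW 41 (.add (.var 41) (.lit 1)))

theorem run_values (hn : s.w 0 = n) (hW : n + 1 < W) :
    Run W valuesProg s (n * 60 + 20) fun s' => s'.w 10 = n ∧ ∀ p < n, s'.wa 0 p = p ∧
      s'.wa 2 p = 0 ∧ s'.wa 3 p = n ∧ s'.ra 5 p = valueQ s p ∧ s'.ra 6 p = valueP s p := by
  have init : Run W (.setW 10 (.var 0) ;; .setW 41 (.lit 0)) s 5 fun s' =>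
      s'.w 10 = n ∧ s'.w 41 = 0 := by
    refine Run.of_wp ⟨?_, ?_, ?_⟩ (by decide) <;> simp [hn] <;> omega
  refine (init.seq fun s₁ f₁ h₁ => Run.loop (s := s₁) n 50 (fun o s' => s'.w 41 = o ∧ o ≤ n ∧
    ∀ p < o, s'.wa 0 p = p ∧ s'.wa 2 p = 0 ∧ s'.wa 3 p = n ∧ s'.ra 5 p = valueQ s p ∧
      s'.ra 6 p = valueP s p) ?_ ?_ ⟨h₁.2, by omega, fun x hx => by omega⟩).mono
    (by simp only [BExp.cost, WExp.cost]; omega) fun _ _ h => h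
  · rintro o s' hf ⟨ho, _, h⟩ hb
    have e0 : s'.w 0 = n := ((hf.w 0 rfl).trans (f₁.w 0 rfl)).trans hn
    simp only [BExp.Holds, WExp.eval, e0] at hb
    refine ⟨by omega, Run.of_wp ?_ (by decide)⟩
    have eQ : s'.ra 4 6 * s'.ra 2 o + s'.ra 4 7 * s'.ra 3 o = valueQ s o := by
      rw [valueQ, hf.ra 4 rfl, hf.ra 2 rfl, hf.ra 3 rfl, f₁.ra 4 rfl, f₁.ra 2 rfl, f₁.ra 3 rfl]
    have eP : s'.ra 4 6 * s'.ra 0 o + s'.ra 4 7 * s'.ra 1 o = valueP s o := by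
      rw [valueP, hf.ra 4 rfl, hf.ra 0 rfl, hf.ra 1 rfl, f₁.ra 4 rfl, f₁.ra 0 rfl, f₁.ra 1 rfl]
    refine ⟨?_, ?_, ?_, ?_, ?_, ?_, ?_, ?_, ?_, ?_, ?_, ?_⟩ <;> simp [ho, e0, coef, eQ, eP]
    any_goals omega
    intro p hp
    split_ifs with hpo
    · simp [hpo]
    · simpa [hpo] using h p (by omega)
  · rintro o s' hf ⟨ho, _, h⟩ hb
    simp only [BExp.Holds, WExp.eval, hf.w 0 rfl, f₁.w 0 rfl, hn] at hb
    exact ⟨(hf.w 10 rfl).trans h₁.1, fun x hx => h x (by omega)⟩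

def gatherProg : Program :=
  .setW 41 (.lit 0) ;; .loop (.not (.wle (.var 0) (.var 41)))
    (.putR 7 (.var 41) (.get 5 (.get 0 (.var 41))) ;; .setW 41 (.add (.var 41) (.lit 1)))

theorem run_gather (hn : s.w 0 = n) (hW : n + 1 < W) :
    Run W gatherProg s (n * 20 + 20) fun s' => ∀ p < n, s'.ra 7 p = s.ra 5 (s.wa 0 p) := by
  have init : Run W (.setW 41 (.lit 0)) s 5 fun s' => s'.w 41 = 0 := by
    refine Run.of_wp ⟨?_, ?_⟩ (by decide) <;> simp
    omega
  refine (init.seq fun s₁ f₁ h₁ => Run.loop (s := s₁) n 10 (fun o s' => s'.w 41 = o ∧ o ≤ n ∧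
    ∀ p < o, s'.ra 7 p = s.ra 5 (s.wa 0 p)) ?_ ?_ ⟨h₁, by omega, fun x hx => by omega⟩).mono
    (by simp only [BExp.cost, WExp.cost]; omega) fun _ _ h => h
  · rintro o s' hf ⟨ho, _, h⟩ hb
    have e0 : s'.w 0 = n := ((hf.w 0 rfl).trans (f₁.w 0 rfl)).trans hn
    simp only [BExp.Holds, WExp.eval, e0] at hb
    refine ⟨by omega, Run.of_wp ?_ (by decide)⟩
    refine ⟨?_, ?_, ?_, ?_, ?_⟩ <;> simp [ho]
    any_goals omega
    intro p hp
    split_ifs with hpo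
    · rw [hpo, hf.ra 5 rfl, hf.wa 0 rfl, f₁.ra 5 rfl, f₁.wa 0 rfl]
    · exact h p (by omega)
  · rintro o s' hf ⟨ho, _, h⟩ hb
    simp only [BExp.Holds, WExp.eval, hf.w 0 rfl, f₁.w 0 rfl, hn] at hb
    exact fun x hx => h x (by omega)

/-- Stores in `r 0` the `w 1`-th largest objective value of a feasible pair. -/
def prog : Program :=
  valuesProg ;; MergeSort.prog ;; gatherProg ;;
    (.setW 40 (.mul (.var 0) (.var 0)) ;; .setW 44 (.lit 0)) ;; searchProg

/-- The running time for `n` points if `2 * n ≤ 2 ^ L`. -/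
def time (n L : ℕ) : ℕ :=
  (6 * L + 1) * (L * (n * 3750 + 650) + n * 1400 + 2210) + L * (n * 150 + 50) + n * 100 + 100

/-- The pair `(x, y)` attaining `v` serves only to start the invariant: row `x` contains `v` at the
rank of `y`. -/
theorem run_prog {x y : ℕ} (hn : s.w 0 = n) (hL : n + n ≤ 2 ^ L) (hW : 8 * n * n + 4 * n + 5 < W)
    (hv : IsAnswer n s v) (hx : x < n) (hy : y < n) (hxy : valueP s x + valueQ s y = v) :
    Run W prog s (time n L) fun s' => s'.r 0 = v := by
  have hnn : 8 * n * n = 8 * (n * n) := mul_assoc _ _ _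
  rw [prog]
  refine Run.mono (T₁ := _ + (_ + (_ + (10 + _)))) ((run_values hn (by omega)).seq fun s₁ f₁ h₁ =>
    (MergeSort.run_prog (pos := id) (n := n) (L := L) h₁.1 ((f₁.w 0 rfl).trans hn) (by omega) rfl
      (by nlinarith) (fun x hx => by rw [(h₁.2 x hx).1]; omega)
      (fun x hx => by rw [(h₁.2 x hx).1]; rfl)).seq fun s₂ f₂ h₂ =>
    (run_gather (n := n) (by rw [f₂.w 0 rfl, f₁.w 0 rfl, hn]) (by omega)).seq fun s₃ f₃ h₃ =>
    (Run.of_wp (Q := fun s₄ => s₄.w 40 = n * n ∧ s₄.w 44 = 0) ?_ (by decide)).seq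
    fun s₄ f₄ h₄ => run_search (v := v) (n := n) ?_ hL hW ?_ ?_ ?_) ?_ fun _ _ h => h
  · have e0 : s₃.w 0 = n := by rw [f₃.w 0 rfl, f₂.w 0 rfl, f₁.w 0 rfl, hn]
    refine ⟨?_, ?_, ?_⟩ <;> simp [e0] <;> omega
  · rw [f₄.w 0 rfl, f₃.w 0 rfl, f₂.w 0 rfl, f₁.w 0 rfl, hn]
  · intro j j' hj hj'
    rw [f₄.ra 7 rfl, h₃ j (by omega), h₃ j' hj', f₂.ra 5 rfl]
    rcases hj.lt_or_eq with hj | rfl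
    · rcases h₂.1.sorted j j' hj hj' with hk | hk
      · exact hk.le
      · exact hk.1.le
    · exact le_rfl
  · refine hv.congr ?_ ?_ ?_ ?_ ?_ fun k _ => ?_
    · rw [f₄.w 1 rfl, f₃.w 1 rfl, f₂.w 1 rfl, f₁.w 1 rfl]
    · rw [f₄.ra 0 rfl, f₃.ra 0 rfl, f₂.ra 0 rfl, f₁.ra 0 rfl]
    · rw [f₄.ra 1 rfl, f₃.ra 1 rfl, f₂.ra 1 rfl, f₁.ra 1 rfl]
    · rw [f₄.ra 2 rfl, f₃.ra 2 rfl, f₂.ra 2 rfl, f₁.ra 2 rfl]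
    · rw [f₄.ra 3 rfl, f₃.ra 3 rfl, f₂.ra 3 rfl, f₁.ra 3 rfl]
    · rw [f₄.ra 4 rfl, f₃.ra 4 rfl, f₂.ra 4 rfl, f₁.ra 4 rfl]
  · have elo : ∀ p < n, s₄.wa 2 p = 0 := fun p hp => by
      rw [f₄.wa 2 rfl, f₃.wa 2 rfl, f₂.wa 2 rfl, (h₁.2 p hp).2.1]
    have ehi : ∀ p < n, s₄.wa 3 p = n := fun p hp => by
      rw [f₄.wa 3 rfl, f₃.wa 3 rfl, f₂.wa 3 rfl, (h₁.2 p hp).2.2.1]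
    refine ⟨fun p hp => (ehi p hp).le, ?_, ?_, fun hc => absurd h₄.2 hc, .inr ?_⟩
    · rw [h₄.1, Finset.sum_congr rfl (g := fun _ => n) fun p hp => ?_]
      · simp
      · rw [width, elo p (Finset.mem_range.1 hp), ehi p (Finset.mem_range.1 hp), Nat.sub_zero]
    · rw [h₄.1]
      simp
    · obtain ⟨j, hj, e⟩ := h₂.1.exists_eq hy
      refine ⟨x, hx, j, ?_, ?_, ?_⟩
      · rw [elo x hx]; omega
      · rw [ehi x hx]; omega
      · rw [f₄.ra 6 rfl, f₄.ra 7 rfl, f₃.ra 6 rfl, f₂.ra 6 rfl, (h₁.2 x hx).2.2.2.2, h₃ j hj, e,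
          f₂.ra 5 rfl, (h₁.2 y hy).1, (h₁.2 y hy).2.2.2.1, hxy]
  · rw [time]
    ring_nf
    omega

end Selection
end RealRAM

namespace MinkowskiSelection

open RealRAM

/-! ## Selection in multisets -/

/-- In the nonincreasing list the first `k` entries are at least `v`, and those from index `k - 1`
on are at most `v`. The threshold form is what a counting program can test. -/
theorem exists_isKthLargest {M : Multiset ℝ} {k : ℕ} (hk : 1 ≤ k) (hM : k ≤ M.card) :
    ∃ v ∈ M, IsKthLargest M k v ∧ ∀ t, k ≤ M.countP (t ≤ ·) ↔ t ≤ v := by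
  obtain ⟨l, hl, hs⟩ : ∃ l, l = M.sort (· ≥ ·) ∧ l.Pairwise (· ≥ ·) :=
    ⟨_, rfl, M.pairwise_sort _⟩
  have hlen : l.length = M.card := by rw [hl, Multiset.length_sort]
  have hcoe : (l : Multiset ℝ) = M := by rw [hl, Multiset.sort_eq]
  have hlt : k - 1 < l.length := by omega
  have hs' := List.pairwise_iff_getElem.1 hs
  refine ⟨l[k - 1], ?_, ⟨hk, by rw [← hl, List.getElem?_eq_getElem hlt]⟩, fun t => ?_⟩
  · rw [← hcoe]
    exact List.getElem_mem hlt
  · rw [← hcoe, Multiset.coe_countP]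
    constructor
    · intro hc
      by_contra ht
      have h₁ : (l.drop (k - 1)).countP (fun x => decide (t ≤ x)) = 0 := by
        rw [List.countP_eq_zero]
        intro x hx
        obtain ⟨i, hi, rfl⟩ := List.mem_iff_getElem.1 hx
        rw [List.getElem_drop, decide_eq_true_eq, not_le]
        refine lt_of_le_of_lt ?_ (not_le.1 ht)
        rcases Nat.eq_zero_or_pos i with rfl | hi'
        · simp
        · exact hs' _ _ hlt (by simp at hi; omega) (by omega)
      have h₂ := List.countP_le_length (p := fun x => decide (t ≤ x)) (l := l.take (k - 1))
      rw [← List.take_append_drop (k - 1) l, List.countP_append, h₁] at hc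
      rw [List.length_take] at h₂
      omega
    · intro ht
      have h₁ : (l.take k).countP (fun x => decide (t ≤ x)) = (l.take k).length := by
        rw [List.countP_eq_length]
        intro x hx
        obtain ⟨i, hi, rfl⟩ := List.mem_iff_getElem.1 hx
        rw [List.getElem_take, decide_eq_true_eq]
        refine ht.trans ?_
        rw [List.length_take] at hi
        rcases (show i = k - 1 ∨ i < k - 1 by omega) with rfl | hi'
        · exact le_rfl
        · exact hs' _ _ (by omega) hlt hi'
      rw [← List.take_append_drop k l, List.countP_append, h₁, List.length_take]
      omega

theorem coe_eq_map_range (P : List (ℝ × ℝ)) :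
    (P : Multiset (ℝ × ℝ)) = (Multiset.range P.length).map fun i => P.getD i (0, 0) := by
  rw [← Multiset.coe_range, Multiset.map_coe]
  congr 1
  refine List.ext_getElem (by simp) fun i h₁ h₂ => ?_
  simp [h₁]

theorem map_product_map {α β γ δ : Type*} (s : Multiset α) (t : Multiset β) (f : α → γ)
    (g : β → δ) : s.map f ×ˢ t.map g = (s ×ˢ t).map (Prod.map f g) := by
  induction s using Multiset.induction_on with
  | empty => simp
  | cons a s ih => simp [ih, Multiset.map_map]

/-! ### From multisets of points to pairs of indices. -/

variable {P Q : List (ℝ × ℝ)} {L₁ L₂ : LinearConstraint} {f : LinearObjective} {n k : ℕ}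

theorem holds_zero_input {x y : ℕ} : PairCount.Holds (input P Q L₁ L₂ f k) 0 x y ↔
    L₁.Holds (P.getD x (0, 0) + Q.getD y (0, 0)) := by
  simp [PairCount.Holds, input, LinearConstraint.Holds]

theorem holds_one_input {x y : ℕ} : PairCount.Holds (input P Q L₁ L₂ f k) 1 x y ↔
    L₂.Holds (P.getD x (0, 0) + Q.getD y (0, 0)) := by
  simp [PairCount.Holds, input, LinearConstraint.Holds]

theorem objective_input {x y : ℕ} : Selection.objective (input P Q L₁ L₂ f k) x y =
    f.value (P.getD x (0, 0) + Q.getD y (0, 0)) := by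
  simp [Selection.objective, input, LinearObjective.value]

/-- Indexing by positions in the lists keeps multiplicities, so that counting index pairs counts
elements of the multiset. -/
theorem constrainedSum_eq (hP : P.length = n) (hQ : Q.length = n) :
    open Classical in
    constrainedSum (P : Multiset (ℝ × ℝ)) (Q : Multiset (ℝ × ℝ)) L₁ L₂ =
      ((Multiset.range n ×ˢ Multiset.range n).filter fun z =>
        PairCount.Holds (input P Q L₁ L₂ f k) 0 z.1 z.2 ∧
          PairCount.Holds (input P Q L₁ L₂ f k) 1 z.1 z.2).map
        fun z => P.getD z.1 (0, 0) + Q.getD z.2 (0, 0) := by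
  classical
  rw [constrainedSum, coe_eq_map_range P, coe_eq_map_range Q, hP, hQ, map_product_map,
    Multiset.map_map, Multiset.filter_map]
  simp only [holds_zero_input, holds_one_input]
  rfl

theorem count_eq_card (p : ℕ → ℕ → Prop) [DecidablePred fun z : ℕ × ℕ => p z.1 z.2] :
    PairCount.count n p =
      ((Multiset.range n ×ˢ Multiset.range n).filter fun z => p z.1 z.2).card := by
  rw [PairCount.count, Finset.card, Finset.filter_val, Finset.product_val, Finset.range_val]
  congr

theorem countP_value_constrainedSum (hP : P.length = n) (hQ : Q.length = n) (t : ℝ) :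
    ((constrainedSum (P : Multiset (ℝ × ℝ)) (Q : Multiset (ℝ × ℝ)) L₁ L₂).map f.value).countP
      (t ≤ ·) = PairCount.count n fun x y => PairCount.Holds (input P Q L₁ L₂ f k) 0 x y ∧
        PairCount.Holds (input P Q L₁ L₂ f k) 1 x y ∧
        t ≤ Selection.objective (input P Q L₁ L₂ f k) x y := by
  classical
  rw [constrainedSum_eq (f := f) (k := k) hP hQ, Multiset.map_map, Multiset.countP_map,
    Multiset.filter_filter, count_eq_card]
  congr 1
  refine Multiset.filter_congr fun z _ => ?_
  rw [objective_input]
  simp only [Function.comp_apply]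
  tauto

/-- The bound for the running time on `n` points. -/
def time (n : ℕ) : ℕ := Selection.time n (Nat.log 2 n + 2)

/-! ### The asymptotic running time and the word size. -/

theorem time_isBigO :
    (fun n : ℕ => (time n : ℝ)) =O[atTop] (fun n : ℕ => (n : ℝ) * Real.log (n : ℝ) ^ 2) := by
  have hbound (n : ℕ) (hn : 2 ≤ n) : time n ≤ 1000000 * (n * (Nat.log 2 n) ^ 2) := by
    have hl : 1 ≤ Nat.log 2 n := Nat.log_pos (by norm_num) hn
    rw [time, Selection.time]
    generalize Nat.log 2 n = l at hl
    have h₁ : n * 1 ≤ n * l := Nat.mul_le_mul_left n hl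
    have h₂ : n * l * 1 ≤ n * l * l := Nat.mul_le_mul_left _ hl
    have h₃ : 1 * l ≤ n * l := Nat.mul_le_mul_right l (by omega)
    have h₄ : 1 * (l * l) ≤ n * (l * l) := Nat.mul_le_mul_right _ (by omega)
    nlinarith
  have hlog (n : ℕ) (hn : 2 ≤ n) : (Nat.log 2 n : ℝ) ≤ 2 * Real.log n := by
    have h := Real.natLog_le_logb n 2
    have h₂ := Real.log_two_gt_d9
    rw [Real.logb, Nat.cast_ofNat, le_div_iff₀ (by linarith)] at h
    have : 0 ≤ (Nat.log 2 n : ℝ) := Nat.cast_nonneg _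
    nlinarith
  -- The factor is `1000000 * 2 ^ 2`: the binary logarithm is at most twice the natural one, because
  -- `log 2 > 1 / 2`.
  refine IsBigO.of_bound 4000000 (eventually_atTop.2 ⟨2, fun n hn => ?_⟩)
  rw [Real.norm_of_nonneg (by positivity), Real.norm_of_nonneg (by positivity)]
  calc (time n : ℝ) ≤ 1000000 * (n * (Nat.log 2 n) ^ 2) := by exact_mod_cast hbound n hn
    _ ≤ 1000000 * (n * (2 * Real.log n) ^ 2) := by gcongr; exact hlog n hn
    _ = 4000000 * (n * Real.log n ^ 2) := by ring

theorem word_bound (hn : 1 ≤ n) : 8 * n * n + 4 * n + 5 < (n + 2) ^ 4 := by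
  obtain ⟨m, rfl⟩ := Nat.exists_eq_add_of_le hn
  ring_nf
  nlinarith [Nat.zero_le (m ^ 3), Nat.zero_le (m ^ 4)]

end MinkowskiSelection

theorem theorem6 :
    ∃ (prog : RealRAM.Program) (c : ℕ) (T : ℕ → ℕ),
      (fun n : ℕ => (T n : ℝ)) =O[atTop] (fun n : ℕ => (n : ℝ) * Real.log (n : ℝ) ^ 2) ∧
      ∀ (n : ℕ) (P Q : List (ℝ × ℝ)) (L₁ L₂ : MinkowskiSelection.LinearConstraint)
        (f : MinkowskiSelection.LinearObjective) (k : ℕ),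
        P.length = n → Q.length = n → 1 ≤ k →
        k ≤ (MinkowskiSelection.constrainedSum (P : Multiset (ℝ × ℝ)) (Q : Multiset (ℝ × ℝ))
          L₁ L₂).card →
        ∃ (s : RealRAM.State) (t : ℕ),
          RealRAM.Exec ((n + 2) ^ c) prog (MinkowskiSelection.input P Q L₁ L₂ f k) s t ∧
          t ≤ T n ∧
          MinkowskiSelection.IsKthLargest
            ((MinkowskiSelection.constrainedSum (P : Multiset (ℝ × ℝ)) (Q : Multiset (ℝ × ℝ))
              L₁ L₂).map f.value) k (s.r 0) := by
  refine ⟨RealRAM.Selection.prog, 4, MinkowskiSelection.time, MinkowskiSelection.time_isBigO, ?_⟩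
  intro n P Q L₁ L₂ f k hP hQ hk hcard
  obtain ⟨v, hv, hkth, hiff⟩ := MinkowskiSelection.exists_isKthLargest (k := k)
    (M := (MinkowskiSelection.constrainedSum (P : Multiset (ℝ × ℝ)) (Q : Multiset (ℝ × ℝ))
      L₁ L₂).map f.value) hk (by rwa [Multiset.card_map])
  classical
  rw [MinkowskiSelection.constrainedSum_eq (f := f) (k := k) hP hQ, Multiset.map_map] at hv
  obtain ⟨⟨x, y⟩, hz, hxy⟩ := Multiset.mem_map.1 hv
  have hz' := Multiset.mem_product.1 (Multiset.mem_filter.1 hz).1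
  simp only [Multiset.mem_range] at hz'
  have hL : n + n ≤ 2 ^ (Nat.log 2 n + 2) := by
    have := Nat.lt_pow_succ_log_self (b := 2) (by norm_num) n
    rw [pow_succ]
    omega
  obtain ⟨s, t, he, ht, hs⟩ := RealRAM.Selection.run_prog (W := (n + 2) ^ 4) (n := n)
    (L := Nat.log 2 n + 2) (s := MinkowskiSelection.input P Q L₁ L₂ f k) (v := v) (x := x) (y := y)
    (by simpa [MinkowskiSelection.input] using hP) hL
    -- Here `1 ≤ n` because the index `x` of an attaining pair is below `n`.
    (MinkowskiSelection.word_bound (by omega))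
    (fun t => by
      rw [← hiff t, MinkowskiSelection.countP_value_constrainedSum (k := k) hP hQ]
      rfl) hz'.1 hz'.2 (by
      rw [← hxy]
      simp [RealRAM.Selection.valueP, RealRAM.Selection.valueQ, MinkowskiSelection.input,
        MinkowskiSelection.LinearObjective.value]
      ring)
  exact ⟨s, t, he, ht, hs ▸ hkth⟩
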